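/- **Setting.** Let $\mathsf{Act}$ be a finite set of visible actions, $\tau\notin\mathsf{Act}$ an internal action, and $\Omega$ an infinite set of success actions with $\Omega\cap(\mathsf{Act}\cup\{\tau\})=\emptyset$. *Processes and tests.* $\Omega$-tests are the terms $P ::= S \mid P\oplus_p P$ with $0<p<1$, where $S ::= \mathbf 0 \mid x.P \mid P\sqcap P \mid S\,\Box\,S \mid S\,|_A\,S$ with $x\in\mathsf{Act}\cup\Omega$ and $A\subseteq\mathsf{Act}$. pCSP processes are the terms without actions from $\Omega$; $\mathsf{sCSP}$ is the set of pCSP processes of sort $S$. A term denotes a finitely supported distribution over terms of sort $S$: $[\![s]\!]=\overline{s}$ (the point distribution) and $[\![P\oplus_pQ]\!]=p[\![P]\!]+(1-p)[\![Q]\!]$. For $x\in\mathsf{Act}\cup\Omega$ and $\alpha\in\mathsf{Act}\cup\Omega\cup\{\tau\}$ the transitions are generated by: $x.P\xrightarrow{x}[\![P]\!]$; $P\sqcap Q\xrightarrow{\tau}[\![P]\!]$ and $P\sqcap Q\xrightarrow{\tau}[\![Q]\!]$; if $s\xrightarrow{x}\Delta$ then $s\,\Box\,t\xrightarrow{x}\Delta$;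 if $s\xrightarrow{\tau}\Delta$ then $s\,\Box\,t\xrightarrow{\tau}\Delta\,\Box\,t$; if $s\xrightarrow{\alpha}\Delta$ with $\alpha\notin A$ then $s\,|_A\,t\xrightarrow{\alpha}\Delta\,|_A\,t$; the symmetric versions of the last three rules; and if $s\xrightarrow{a}\Delta$, $t\xrightarrow{a}\Theta$ with $a\in A$ then $s\,|_A\,t\xrightarrow{\tau}\Delta\,|_A\,\Theta$. Operators are extended from states to distributions in the obvious way, and $|_A$ is extended to arbitrary terms by distributing it over $\oplus_p$. *Outcomes.* For a label $\alpha$ and $o\in[0,1]^\Omega$ let $(\alpha!o)(\omega)=1$ if $\omega=\alpha$ and $(\alpha!o)(\omega)=o(\omega)$ otherwise. Define recursively $\mathbb V(s)\subseteq[0,1]^\Omega$ as the convex hull of $\bigcup\{\alpha!\,\mathbb V(\Delta)\mid s\xrightarrow{\alpha}\Delta\}$ if $s$ has a transition, and $\mathbb V(s)=\{\vec 0\}$ otherwise, where $\mathbb V(\Delta)$ is the set of all $\sum_s\Delta(s)f(s)$ with $f(s)\in\mathbb V(s)$ for all $s$. For a test $T$, a process $P$ and a finitely supported distribution $\Delta$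 over $\mathsf{sCSP}$ put $\mathcal A(T,P)=\mathbb V([\![T\,|_{\mathsf{Act}}\,P]\!])$ and $\mathcal A(T,\Delta)=\{\sum_s\Delta(s)f(s)\mid f(s)\in\mathcal A(T,s)\text{ for all }s\}$. Comparing tuples componentwise, $P\sqsubseteq^\Omega_{\mathrm{pmay}}Q$ means that for every $\Omega$-test $T$ each element of $\mathcal A(T,P)$ is $\le$ some element of $\mathcal A(T,Q)$, and $P\sqsubseteq^\Omega_{\mathrm{pmust}}Q$ means that for every $\Omega$-test $T$ each element of $\mathcal A(T,Q)$ is $\ge$ some element of $\mathcal A(T,P)$. *Logic.* A relation $R$ between states and distributions lifts to distributions: $\Delta\,\overline R\,\Theta$ iff $\Delta=\sum_ip_i\overline{s_i}$ and $\Theta=\sum_ip_i\Phi_i$ with $s_i\,R\,\Phi_i$ for all $i$ in a finite index set, where $p_i\ge0$ and $\sum_ip_i=1$. Let $\Rightarrow$ be the reflexive transitive closure of the lifting of the relation "$s\xrightarrow{\tau}\Delta$ or $\Delta=\overline s$", and let $\Delta\stackrel{a}{\Rightarrow}\Theta$ be the composition of $\Rightarrow$, the lifting of $\xrightarrow{a}$,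 and $\Rightarrow$. The set $\mathcal F$ of formulae is $\varphi ::= \mathrm{ref}(X)\mid\langle a\rangle\varphi\mid\bigwedge_{i\in I}\varphi_i\mid\bigoplus_{i\in I}p_i\cdot\varphi_i$ with $X\subseteq\mathsf{Act}$, $a\in\mathsf{Act}$, $I$ finite, $p_i\in[0,1]$ and $\sum_ip_i=1$; $\mathcal L\subseteq\mathcal F$ consists of the formulae without $\mathrm{ref}$. For a finitely supported distribution $\Delta$ over $\mathsf{sCSP}$: $\Delta\models\mathrm{ref}(X)$ iff $\Delta\Rightarrow\Delta'$ for some $\Delta'$ in whose support no state has a transition labelled in $X\cup\{\tau\}$; $\Delta\models\langle a\rangle\varphi$ iff $\Delta\stackrel{a}{\Rightarrow}\Delta'$ for some $\Delta'\models\varphi$; $\Delta\models\bigwedge_i\varphi_i$ iff $\Delta\models\varphi_i$ for all $i$; $\Delta\models\bigoplus_ip_i\cdot\varphi_i$ iff $\Delta\Rightarrow\sum_ip_i\Delta_i$ for some distributions $\Delta_i$ over $\mathsf{sCSP}$ with $\Delta_i\models\varphi_i$ for all $i$. Write $P\sqsubseteq^{\mathcal L}Q$ iff $[\![P]\!]\models\varphi$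 implies $[\![Q]\!]\models\varphi$ for all $\varphi\in\mathcal L$, and $P\sqsubseteq^{\mathcal F}Q$ iff $[\![Q]\!]\models\varphi$ implies $[\![P]\!]\models\varphi$ for all $\varphi\in\mathcal F$. **Theorem.** For all pCSP processes $P,Q$: 1. if $P\sqsubseteq^\Omega_{\mathrm{pmay}}Q$ then $P\sqsubseteq^{\mathcal L}Q$; 2. if $P\sqsubseteq^\Omega_{\mathrm{pmust}}Q$ then $P\sqsubseteq^{\mathcal F}Q$. Moreover, 3. for every $\varphi\in\mathcal F$ there are an $\Omega$-test $T_\varphi$ and $v_\varphi\in[0,1]^\Omega$ such that, for every finitely supported distribution $\Delta$ over $\mathsf{sCSP}$, $\Delta\models\varphi$ iff some $o\in\mathcal A(T_\varphi,\Delta)$ satisfies $o\le v_\varphi$; and, if $\varphi\in\mathcal L$, with the same $T_\varphi$ and $v_\varphi$ also $\Delta\models\varphi$ iff some $o\in\mathcal A(T_\varphi,\Delta)$ satisfies $o\ge v_\varphi$. -/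

import Mathlib

noncomputable section

namespace PCSP

universe u v

/-! ### Syntax -/

mutual

/-- Process terms `P ::= S | P ⊕_p P` with `0 < p < 1`, over the visible actions `Act` and the
success actions `Ω` (a set disjoint from `Act`). -/
inductive Proc (Act : Type u) (Ω : Type v)
  | state : State Act Ω → Proc Act Ω
  | prob : Set.Ioo (0 : ℝ) 1 → Proc Act Ω → Proc Act Ω → Proc Act Ω

/-- State-based process terms `S ::= 0 | a.P | P ⊓ P | S □ S | S |_A S` with `A ⊆ Act`.
The prefix is an element of `Act` or of `Ω`. -/
inductive State (Act : Type u) (Ω : Type v)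
  | nil : State Act Ω
  | pre : Act ⊕ Ω → Proc Act Ω → State Act Ω
  | int : Proc Act Ω → Proc Act Ω → State Act Ω
  | ext : State Act Ω → State Act Ω → State Act Ω
  | par : Set Act → State Act Ω → State Act Ω → State Act Ω

end

/-- The set pCSP of processes: terms without success actions. -/
abbrev PureProc (Act : Type*) := Proc Act Empty

/-- The set sCSP of state-based processes: state terms without success actions. -/
abbrev PureState (Act : Type*) := State Act Empty

/-- An `Ω`-test is a term that may contain subterms `ω.P` with `ω ∈ Ω`. -/
abbrev OmegaTest (Act Ω : Type*) := Proc Act Ω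

mutual

/-- A process regarded as a term over the larger set of actions `Act ∪ Ω`. -/
def Proc.embed {Act Ω : Type*} : Proc Act Empty → Proc Act Ω
  | .state s => .state s.embed
  | .prob p P Q => .prob p P.embed Q.embed

/-- A state-based process regarded as a term over the larger set of actions `Act ∪ Ω`. -/
def State.embed {Act Ω : Type*} : State Act Empty → State Act Ω
  | .nil => .nil
  | .pre x P => .pre (Sum.map id Empty.elim x) P.embed
  | .int P Q => .int P.embed Q.embed
  | .ext s t => .ext s.embed t.embed
  | .par A s t => .par A s.embed t.embed

end

/-- `s |_A Q` for a state `s`, distributing `|_A` over the probabilistic choices in `Q`. -/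
def Proc.parState {Act Ω : Type*} (A : Set Act) (s : State Act Ω) : Proc Act Ω → Proc Act Ω
  | .state t => .state (.par A s t)
  | .prob p P Q => .prob p (Proc.parState A s P) (Proc.parState A s Q)

/-- `P |_A Q` for arbitrary terms: the abbreviation obtained by distributing `|_A` over
the probabilistic choices in `P` and `Q`. -/
def Proc.par {Act Ω : Type*} (A : Set Act) : Proc Act Ω → Proc Act Ω → Proc Act Ω
  | .state s, R => Proc.parState A s R
  | .prob p P Q, R => .prob p (Proc.par A P R) (Proc.par A Q R)

/-! ### Distributions -/

/-- Probability distributions with finite support. -/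
abbrev FDist (S : Type*) := Convexity.StdSimplex ℝ S

/-- The expected value `∑ s, Δ(s) • f(s)` of a function into a real vector space. -/
def FDist.expect {S X : Type*} [AddCommGroup X] [Module ℝ X] (Δ : FDist S) (f : S → X) : X :=
  Δ.weights.sum fun s p => p • f s

/-- The set of expected values of all choice functions `f` of `F`. -/
def FDist.expectSet {S X : Type*} [AddCommGroup X] [Module ℝ X] (Δ : FDist S) (F : S → Set X) :
    Set X :=
  {x | ∃ f : S → X, (∀ s, f s ∈ F s) ∧ x = FDist.expect Δ f}

/-- The convex combination `∑ i, p i • Δ i` of distributions. -/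
def FDist.mix {I S : Type*} (p : FDist I) (Δ : I → FDist S) : FDist S :=
  (p.map Δ).sConvexComb

/-- The distribution of `g s t` for independent `s` and `t`, distributed as `Δ` and `Θ`. -/
def FDist.map₂ {S T U : Type*} (g : S → T → U) (Δ : FDist S) (Θ : FDist T) : FDist U :=
  FDist.mix Δ fun s => Θ.map (g s)

/-- The lifting of a relation between states and distributions to a relation between
distributions. -/
def Lift {S : Type*} (R : S → FDist S → Prop) (Δ Θ : FDist S) : Prop :=
  ∃ (n : ℕ) (p : FDist (Fin n)) (s : Fin n → S) (Φ : Fin n → FDist S),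
    Δ = FDist.mix p (fun i => Convexity.StdSimplex.single (s i)) ∧ (∀ i, R (s i) (Φ i)) ∧ Θ = FDist.mix p Φ

/-! ### Operational semantics -/

/-- The distribution over states denoted by a term. -/
def Proc.den {Act Ω : Type*} : Proc Act Ω → FDist (State Act Ω)
  | .state s => Convexity.StdSimplex.single s
  | .prob p P Q =>
      Convexity.convexCombPair p.1 (1 - p.1) p.2.1.le (sub_nonneg.2 p.2.2.le) (add_sub_cancel _ _)
        P.den Q.den

/-- Transition labels: the internal action `τ` and the visible and success actions. -/
abbrev Label (Act Ω : Type*) := Option (Act ⊕ Ω)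

/-- The internal action. -/
abbrev tau {Act Ω : Type*} : Label Act Ω := none

/-- A visible action as a label. -/
abbrev vis {Act Ω : Type*} (a : Act) : Label Act Ω := some (Sum.inl a)

/-- A success action as a label. -/
abbrev succ {Act Ω : Type*} (ω : Ω) : Label Act Ω := some (Sum.inr ω)

/-- The transition relation. -/
inductive Step {Act Ω : Type*} : State Act Ω → Label Act Ω → FDist (State Act Ω) → Prop
  | action (x : Act ⊕ Ω) (P : Proc Act Ω) : Step (.pre x P) (some x) P.den
  | int_l (P Q : Proc Act Ω) : Step (.int P Q) tau P.den
  | int_r (P Q : Proc Act Ω) : Step (.int P Q) tau Q.den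
  | ext_l {s₁ s₂ : State Act Ω} {x : Act ⊕ Ω} {Δ : FDist (State Act Ω)} :
      Step s₁ (some x) Δ → Step (.ext s₁ s₂) (some x) Δ
  | ext_r {s₁ s₂ : State Act Ω} {x : Act ⊕ Ω} {Δ : FDist (State Act Ω)} :
      Step s₂ (some x) Δ → Step (.ext s₁ s₂) (some x) Δ
  | ext_i_l {s₁ s₂ : State Act Ω} {Δ : FDist (State Act Ω)} :
      Step s₁ tau Δ → Step (.ext s₁ s₂) tau (Δ.map fun t => .ext t s₂)
  | ext_i_r {s₁ s₂ : State Act Ω} {Δ : FDist (State Act Ω)} :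
      Step s₂ tau Δ → Step (.ext s₁ s₂) tau (Δ.map fun t => .ext s₁ t)
  | par_l {A : Set Act} {s₁ s₂ : State Act Ω} {α : Label Act Ω} {Δ : FDist (State Act Ω)} :
      Step s₁ α Δ → (∀ a ∈ A, α ≠ vis a) → Step (.par A s₁ s₂) α (Δ.map fun t => .par A t s₂)
  | par_r {A : Set Act} {s₁ s₂ : State Act Ω} {α : Label Act Ω} {Δ : FDist (State Act Ω)} :
      Step s₂ α Δ → (∀ a ∈ A, α ≠ vis a) → Step (.par A s₁ s₂) α (Δ.map fun t => .par A s₁ t)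
  | par_i {A : Set Act} {s₁ s₂ : State Act Ω} {a : Act} {Δ₁ Δ₂ : FDist (State Act Ω)} :
      Step s₁ (vis a) Δ₁ → Step s₂ (vis a) Δ₂ → a ∈ A →
        Step (.par A s₁ s₂) tau (FDist.map₂ (.par A) Δ₁ Δ₂)

/-- `s →τ̂ Δ`: a `τ`-step or no step. -/
def HatTau {Act Ω : Type*} (s : State Act Ω) (Δ : FDist (State Act Ω)) : Prop :=
  Step s tau Δ ∨ Δ = Convexity.StdSimplex.single s

/-- The weak transition `⇒τ̂`: the reflexive and transitive closure of the lifting of `→τ̂`. -/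
def WeakTau {Act Ω : Type*} : FDist (State Act Ω) → FDist (State Act Ω) → Prop :=
  Relation.ReflTransGen (Lift HatTau)

/-- The weak transition `⇒â` for a visible action `a`. -/
def WeakVis {Act Ω : Type*} (a : Act) (Δ Θ : FDist (State Act Ω)) : Prop :=
  ∃ Δ₁ Δ₂, WeakTau Δ Δ₁ ∧ Lift (fun s Φ => Step s (vis a) Φ) Δ₁ Δ₂ ∧ WeakTau Δ₂ Θ

/-- `s` can perform neither `τ` nor any action in `X`. -/
def State.Refuses {Act Ω : Type*} (s : State Act Ω) (X : Set Act) : Prop :=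
  (∀ Δ, ¬ Step s tau Δ) ∧ ∀ a ∈ X, ∀ Δ, ¬ Step s (vis a) Δ

/-- Every state in the support of `Δ` refuses `X`. -/
def RefusesDist {Act Ω : Type*} (Δ : FDist (State Act Ω)) (X : Set Act) : Prop :=
  ∀ s ∈ Δ.weights.support, s.Refuses X

/-! ### Modal logic -/

/-- The set `𝓕` of modal formulae. -/
inductive Formula (Act : Type*)
  | ref : Set Act → Formula Act
  | diam : Act → Formula Act → Formula Act
  | conj : (n : ℕ) → (Fin n → Formula Act) → Formula Act
  | psum : (n : ℕ) → FDist (Fin n) → (Fin n → Formula Act) → Formula Act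

/-- The subset `𝓛` of the formulae that are built without the clause `ref X`. -/
def Formula.InL {Act : Type*} : Formula Act → Prop
  | .ref _ => False
  | .diam _ φ => φ.InL
  | .conj _ φ => ∀ i, (φ i).InL
  | .psum _ _ φ => ∀ i, (φ i).InL

/-- The satisfaction relation between distributions over sCSP and formulae. -/
def Sat {Act : Type*} : FDist (PureState Act) → Formula Act → Prop
  | Δ, .ref X => ∃ Δ', WeakTau Δ Δ' ∧ RefusesDist Δ' X
  | Δ, .diam a φ => ∃ Δ', WeakVis a Δ Δ' ∧ Sat Δ' φ
  | Δ, .conj _ φ => ∀ i, Sat Δ (φ i)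
  | Δ, .psum n p φ =>
      ∃ Θ : Fin n → FDist (PureState Act), (∀ i, Sat (Θ i) (φ i)) ∧ WeakTau Δ (FDist.mix p Θ)

/-- The logical preorder `⊑^𝓛`. -/
def LogicL {Act : Type*} (P Q : PureProc Act) : Prop :=
  ∀ φ : Formula Act, φ.InL → Sat P.den φ → Sat Q.den φ

/-- The logical preorder `⊑^𝓕` (in the opposite direction). -/
def LogicF {Act : Type*} (P Q : PureProc Act) : Prop :=
  ∀ φ : Formula Act, Sat Q.den φ → Sat P.den φ

/-! ### Finiteness of the transition system

A size of terms that decreases along transitions; it is used only to justify the recursion in the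
definition of the results-gathering function. -/

mutual

/-- The size of a term. -/
def Proc.size {Act Ω : Type*} : Proc Act Ω → ℕ
  | .state s => s.size
  | .prob _ P Q => P.size + Q.size

/-- The size of a state-based term. -/
def State.size {Act Ω : Type*} : State Act Ω → ℕ
  | .nil => 0
  | .pre _ P => P.size + 1
  | .int P Q => P.size + Q.size + 1
  | .ext s t => s.size + t.size + 1
  | .par _ s t => s.size + t.size + 1

end

theorem FDist.mem_support_map {S T : Type*} {g : S → T} {Δ : FDist S} {t : T}
    (ht : t ∈ (Δ.map g).weights.support) : ∃ s ∈ Δ.weights.support, g s = t := by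
  classical
  have h := Finsupp.mapDomain_support (by simpa using ht)
  simpa using h

theorem FDist.mem_support_mix {I S : Type*} {p : FDist I} {Δ : I → FDist S} {s : S}
    (hs : s ∈ (FDist.mix p Δ).weights.support) :
    ∃ i ∈ p.weights.support, s ∈ (Δ i).weights.support := by
  classical
  rw [FDist.mix, Convexity.StdSimplex.weights_sConvexComb] at hs
  obtain ⟨d, hd, hs⟩ := Finset.mem_biUnion.1 (Finsupp.support_sum hs)
  obtain ⟨i, hi, rfl⟩ := FDist.mem_support_map hd
  exact ⟨i, hi, Finsupp.support_smul hs⟩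

theorem FDist.mem_support_map₂ {S T U : Type*} {g : S → T → U} {Δ : FDist S} {Θ : FDist T} {u : U}
    (hu : u ∈ (FDist.map₂ g Δ Θ).weights.support) :
    ∃ s ∈ Δ.weights.support, ∃ t ∈ Θ.weights.support, g s t = u := by
  obtain ⟨s, hs, hu⟩ := FDist.mem_support_mix hu
  exact ⟨s, hs, FDist.mem_support_map hu⟩

theorem Proc.size_of_mem_support_den {Act Ω : Type*} {t : State Act Ω} :
    ∀ P : Proc Act Ω, t ∈ P.den.weights.support → t.size ≤ P.size
  | .state s, ht => by
      classical
      rw [Proc.den, Convexity.StdSimplex.weights_single] at ht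
      have := Finsupp.support_single_subset ht
      rw [Finset.mem_singleton] at this
      simp [this, Proc.size]
  | .prob p P Q, ht => by
      classical
      rw [Proc.den, Convexity.StdSimplex.weights_convexCombPair] at ht
      rw [Proc.size]
      rcases Finset.mem_union.1 (Finsupp.support_add ht) with h | h
      · exact (Proc.size_of_mem_support_den P (Finsupp.support_smul h)).trans (Nat.le_add_right _ _)
      · exact (Proc.size_of_mem_support_den Q (Finsupp.support_smul h)).trans (Nat.le_add_left _ _)

theorem Step.size_lt {Act Ω : Type*} {s : State Act Ω} {α : Label Act Ω}
    {Δ : FDist (State Act Ω)} (h : Step s α Δ) :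
    ∀ t ∈ Δ.weights.support, t.size < s.size := by
  induction h with
  | action x P =>
      intro t ht
      have := Proc.size_of_mem_support_den P ht
      rw [State.size]; omega
  | int_l P Q =>
      intro t ht
      have := Proc.size_of_mem_support_den P ht
      rw [State.size]; omega
  | int_r P Q =>
      intro t ht
      have := Proc.size_of_mem_support_den Q ht
      rw [State.size]; omega
  | ext_l _ ih =>
      intro t ht
      have := ih t ht
      rw [State.size]; omega
  | ext_r _ ih =>
      intro t ht
      have := ih t ht
      rw [State.size]; omega
  | ext_i_l _ ih =>
      intro t ht
      obtain ⟨u, hu, rfl⟩ := FDist.mem_support_map ht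
      have := ih u hu
      rw [State.size, State.size]; omega
  | ext_i_r _ ih =>
      intro t ht
      obtain ⟨u, hu, rfl⟩ := FDist.mem_support_map ht
      have := ih u hu
      rw [State.size, State.size]; omega
  | par_l _ _ ih =>
      intro t ht
      obtain ⟨u, hu, rfl⟩ := FDist.mem_support_map ht
      have := ih u hu
      rw [State.size, State.size]; omega
  | par_r _ _ ih =>
      intro t ht
      obtain ⟨u, hu, rfl⟩ := FDist.mem_support_map ht
      have := ih u hu
      rw [State.size, State.size]; omega
  | par_i _ _ _ ih₁ ih₂ =>
      intro t ht
      obtain ⟨u, hu, v, hv, rfl⟩ := FDist.mem_support_map₂ ht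
      have := ih₁ u hu
      have := ih₂ v hv
      rw [State.size, State.size]; omega

/-! ### Vector-based testing -/

open Classical in
/-- The operation `α!` on tuples: set the component at `α` to `1` if `α` is a success action. -/
def bang {Act Ω : Type*} (α : Label Act Ω) (o : Ω → ℝ) : Ω → ℝ :=
  fun ω => if succ ω = α then 1 else o ω

open Classical in
/-- The action-based, vector-based, convex-closed results-gathering function on states.
The choice functions `f` are constrained only on the support of `Δ`, for the sake of the
recursion; the defining equation, with unrestricted choice functions, is `results_eq` below. -/
def results {Act Ω : Type*} (s : State Act Ω) : Set (Ω → ℝ) :=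
  if ∃ α Δ, Step s α Δ then
    convexHull ℝ {o | ∃ (α : Label Act Ω) (Δ : FDist (State Act Ω)) (_ : Step s α Δ)
      (f : State Act Ω → Ω → ℝ),
        (∀ t, ∀ _ : t ∈ Δ.weights.support, f t ∈ results t) ∧ o = bang α (FDist.expect Δ f)}
  else {0}
termination_by s.size
decreasing_by exact Step.size_lt ‹_› _ ‹_›

/-- The results-gathering function on distributions. -/
def resultsDist {Act Ω : Type*} (Δ : FDist (State Act Ω)) : Set (Ω → ℝ) :=
  FDist.expectSet Δ results

theorem results_nonempty {Act Ω : Type*} (s : State Act Ω) : (results s).Nonempty := by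
  classical
  induction hn : s.size using Nat.strong_induction_on generalizing s with
  | _ n ih =>
    subst hn
    rw [results]
    split_ifs with h
    · obtain ⟨α, Δ, h⟩ := h
      rw [convexHull_nonempty_iff]
      have key : ∀ t, ∃ o : Ω → ℝ, t ∈ Δ.weights.support → o ∈ results t := fun t => by
        by_cases ht : t ∈ Δ.weights.support
        · obtain ⟨o, ho⟩ := ih _ (h.size_lt t ht) t rfl
          exact ⟨o, fun _ => ho⟩
        · exact ⟨0, fun h' => absurd h' ht⟩
      choose f hf using key
      exact ⟨_, α, Δ, h, f, hf, rfl⟩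
    · exact Set.singleton_nonempty 0

open Classical in
/-- The defining equation of the results-gathering function. -/
theorem results_eq {Act Ω : Type*} (s : State Act Ω) :
    results s =
      if ∃ α Δ, Step s α Δ then
        convexHull ℝ (⋃ (α : Label Act Ω) (Δ : FDist (State Act Ω)) (_ : Step s α Δ),
          bang α '' resultsDist Δ)
      else {0} := by
  rw [results]
  congr 2
  ext o
  simp only [Set.mem_ofPred_eq, Set.mem_iUnion, Set.mem_image, resultsDist, FDist.expectSet]
  constructor
  · rintro ⟨α, Δ, h, f, hf, rfl⟩
    refine ⟨α, Δ, h, _, ⟨fun t => if t ∈ Δ.weights.support then f t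
      else (results_nonempty t).some, fun t => ?_, rfl⟩, ?_⟩
    · dsimp only
      split_ifs with ht
      · exact hf t ht
      · exact (results_nonempty t).some_mem
    · congr 1
      refine Finset.sum_congr rfl fun t ht => ?_
      dsimp only
      rw [if_pos ht]
  · rintro ⟨α, Δ, h, _, ⟨f, hf, rfl⟩, rfl⟩
    exact ⟨α, Δ, h, f, fun t _ => hf t, rfl⟩

/-- The set of outcomes of applying the `Ω`-test `T` to the process `P`: the results of
`T |_Act P`. -/
def outcomes {Act Ω : Type*} (T : OmegaTest Act Ω) (P : PureProc Act) : Set (Ω → ℝ) :=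
  resultsDist (Proc.par Set.univ T P.embed).den

/-- The set of outcomes of applying `T` to a distribution over state-based processes. -/
def outcomesDist {Act Ω : Type*} (T : OmegaTest Act Ω) (Δ : FDist (PureState Act)) :
    Set (Ω → ℝ) :=
  FDist.expectSet Δ fun s => outcomes T (.state s)

/-- The Hoare preorder on sets of tuples. -/
def HoareLE {X : Type*} [LE X] (A B : Set X) : Prop := ∀ x ∈ A, ∃ y ∈ B, x ≤ y

/-- The Smyth preorder on sets of tuples. -/
def SmythLE {X : Type*} [LE X] (A B : Set X) : Prop := ∀ y ∈ B, ∃ x ∈ A, x ≤ y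

/-- The vector-based may preorder. -/
def VecMay {Act : Type*} (Ω : Type*) (P Q : PureProc Act) : Prop :=
  ∀ T : OmegaTest Act Ω, HoareLE (outcomes T P) (outcomes T Q)

/-- The vector-based must preorder. -/
def VecMust {Act : Type*} (Ω : Type*) (P Q : PureProc Act) : Prop :=
  ∀ T : OmegaTest Act Ω, SmythLE (outcomes T P) (outcomes T Q)

end PCSP

end

noncomputable section

namespace PCSP

open Convexity

namespace FDist

variable {I J S T U X Y : Type*} [AddCommGroup X] [Module ℝ X] [AddCommGroup Y] [Module ℝ Y]

/-! ### Expected values -/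

-- Part 3 carries everything: a test and a tuple that characterise a formula turn a comparison of
-- outcome sets into a comparison of satisfied formulae. Both halves of part 3 come from one
-- invariant, `Characterises`: satisfaction puts `v` itself among the outcomes, an outcome below `v`
-- forces satisfaction, and `v` and all outcomes are nonnegative, supported in a prescribed set `U`,
-- with total at most 1. The bound on the total holds because these tests stop after their first
-- success. For formulae without `ref` the total of `v` is exactly 1, so an outcome above `v` equals
-- `v` (`eq_of_le_of_mem_subUnit`), and the statement for `≥` follows from the one for `≤`.
--
-- The tests are built by recursion on the formula with fresh success actions. For `ref(X)`, offer
-- every action of `X` followed by success, with `v = 0`. For `⟨a⟩φ`, offer the test of `φ` after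
-- `a` beside a fresh success that penalises any other course. For a conjunction, mix tests with
-- disjoint supports. For a probabilistic choice, let the test choose internally between the `T i`,
-- each mixed evenly with a mark `ω i`; the marks record the probabilities with which the
-- alternatives were chosen. These must be at most `p`, and both families sum to 1, so they equal
-- `p`.
--
-- That satisfaction yields `v` rests on `outcomesDist_subset_of_weakTau`. The converse rests on
-- `expectSet_outcomesState_subset`, which bounds all outcomes of a test by induction on the
-- process. Convexity of result sets, through `FDist.exists_disintegration`, allows mixtures to be
-- treated componentwise although a choice function has only one value per state.

theorem expect_eq_linearCombination (Δ : FDist S) (f : S → X) :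
    expect Δ f = Finsupp.linearCombination ℝ f Δ.weights := rfl

theorem expect_congr {Δ : FDist S} {f g : S → X}
    (h : ∀ s ∈ Δ.weights.support, f s = g s) : expect Δ f = expect Δ g :=
  Finset.sum_congr rfl fun s hs => by simp only [h s hs]

@[simp]
theorem expect_single (s : S) (f : S → X) : expect (StdSimplex.single s) f = f s := by
  simp [expect_eq_linearCombination]

@[simp]
theorem expect_map (g : S → T) (Δ : FDist S) (f : T → X) :
    expect (Δ.map g) f = expect Δ fun s => f (g s) := by
  simp [expect_eq_linearCombination, Finsupp.linearCombination_mapDomain, Function.comp_def]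

theorem map_expect (L : X →ₗ[ℝ] Y) (Δ : FDist S) (f : S → X) :
    L (expect Δ f) = expect Δ fun s => L (f s) := by
  simp [expect, Finsupp.sum, map_sum]

theorem expect_apply {V : Type*} (Δ : FDist S) (f : S → V → ℝ) (v : V) :
    expect Δ f v = expect Δ fun s => f s v :=
  map_expect (LinearMap.proj v) Δ f

theorem expect_add (Δ : FDist S) (f g : S → X) :
    expect Δ (fun s => f s + g s) = expect Δ f + expect Δ g := by
  simp [expect, Finsupp.sum, Finset.sum_add_distrib]

theorem expect_smul (Δ : FDist S) (c : ℝ) (f : S → X) :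
    expect Δ (fun s => c • f s) = c • expect Δ f := by
  simp only [expect, Finsupp.sum, Finset.smul_sum]
  exact Finset.sum_congr rfl fun s _ => smul_comm _ _ _

theorem expect_comm (Δ : FDist S) (Θ : FDist T) (f : S → T → X) :
    expect Δ (fun s => expect Θ (f s)) = expect Θ fun t => expect Δ fun s => f s t := by
  simp only [expect, Finsupp.sum, Finset.smul_sum]
  rw [Finset.sum_comm]
  exact Finset.sum_congr rfl fun t _ => Finset.sum_congr rfl fun s _ => smul_comm _ _ _

@[simp]
theorem expect_const (Δ : FDist S) (x : X) : expect Δ (fun _ => x) = x := by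
  simp only [expect, Finsupp.sum, ← Finset.sum_smul]
  rw [show ∑ s ∈ Δ.weights.support, Δ.weights s = 1 from Δ.total, one_smul]

theorem expect_mem {C : Set X} (hC : Convex ℝ C) {Δ : FDist S} {f : S → X}
    (hf : ∀ s ∈ Δ.weights.support, f s ∈ C) : expect Δ f ∈ C :=
  hC.sum_mem (fun _ _ => Δ.weights_nonneg _) Δ.total hf

theorem expect_fintype [Fintype S] (Δ : FDist S) (f : S → X) :
    expect Δ f = ∑ s, Δ.weights s • f s := by
  simp [expect, Finsupp.sum_fintype]

theorem sum_weights [Fintype S] (Δ : FDist S) : ∑ s, Δ.weights s = 1 := by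
  simpa [expect_fintype, Finsupp.sum_fintype] using Δ.total

/-! ### Convex combinations -/

theorem weights_mix (p : FDist I) (Δ : I → FDist S) :
    (mix p Δ).weights = expect p fun i => (Δ i).weights := by
  rw [mix, StdSimplex.weights_sConvexComb]
  exact expect_map Δ p fun Θ => Θ.weights

@[simp]
theorem expect_mix (p : FDist I) (Δ : I → FDist S) (f : S → X) :
    expect (mix p Δ) f = expect p fun i => expect (Δ i) f := by
  rw [expect_eq_linearCombination, weights_mix, map_expect]
  rfl

theorem mix_congr {p : FDist I} {Δ Θ : I → FDist S}
    (h : ∀ i ∈ p.weights.support, Δ i = Θ i) : mix p Δ = mix p Θ := by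
  apply StdSimplex.ext
  rw [weights_mix, weights_mix]
  exact expect_congr fun i hi => by rw [h i hi]

@[simp]
theorem mix_mix (p : FDist I) (Δ : I → FDist J) (Θ : J → FDist S) :
    mix (mix p Δ) Θ = mix p fun i => mix (Δ i) Θ := by
  apply StdSimplex.ext
  simp only [weights_mix, expect_mix]

@[simp]
theorem mix_map (p : FDist I) (g : I → J) (Δ : J → FDist S) :
    mix (p.map g) Δ = mix p fun i => Δ (g i) := by
  apply StdSimplex.ext
  simp only [weights_mix, expect_map]

@[simp]
theorem mix_single (i : I) (Δ : I → FDist S) : mix (StdSimplex.single i) Δ = Δ i := by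
  apply StdSimplex.ext
  simp only [weights_mix, expect_single]

@[simp]
theorem mix_const (p : FDist I) (Δ : FDist S) : mix p (fun _ => Δ) = Δ := by
  apply StdSimplex.ext
  simp only [weights_mix, expect_const]

theorem map_eq_mix (p : FDist I) (g : I → S) :
    p.map g = mix p fun i => StdSimplex.single (g i) := by
  rw [← mix_map p g StdSimplex.single]
  apply StdSimplex.ext
  rw [weights_mix]
  simp [expect]

@[simp]
theorem mix_single_right (p : FDist S) : mix p StdSimplex.single = p := by
  rw [← map_eq_mix p fun s => s]
  exact StdSimplex.map_id p

@[simp]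
theorem map_mix (g : S → T) (p : FDist I) (Δ : I → FDist S) :
    (mix p Δ).map g = mix p fun i => (Δ i).map g := by
  simp only [map_eq_mix, mix_mix]

theorem map_congr {g h : S → T} {Δ : FDist S} (H : ∀ s ∈ Δ.weights.support, g s = h s) :
    Δ.map g = Δ.map h := by
  simp only [map_eq_mix]
  exact mix_congr fun s hs => by rw [H s hs]

/-- The distribution on two points. -/
def coin (a b : ℝ) (ha : 0 ≤ a) (hb : 0 ≤ b) (h : a + b = 1) : FDist (Fin 2) :=
  StdSimplex.duple 0 1 ha hb h

theorem expect_coin {a b : ℝ} (ha : 0 ≤ a) (hb : 0 ≤ b) (h : a + b = 1) (f : Fin 2 → X) :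
    expect (coin a b ha hb h) f = a • f 0 + b • f 1 := by
  simp [coin, expect_eq_linearCombination]

theorem convexCombPair_eq_mix {a b : ℝ} (ha : 0 ≤ a) (hb : 0 ≤ b) (h : a + b = 1)
    (Δ Θ : FDist S) :
    convexCombPair a b ha hb h Δ Θ = mix (coin a b ha hb h) ![Δ, Θ] := by
  apply StdSimplex.ext
  rw [weights_mix, expect_coin]
  simp

theorem exists_mem_support (p : FDist I) : ∃ i, i ∈ p.weights.support :=
  p.support_weights_nonempty

/-- `Lift` and `ConvexFamily` are indexed by `Fin n`. Enumerating the support reduces any mixture to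
that case and discards zero weights. -/
theorem exists_fin (p : FDist I) :
    ∃ (n : ℕ) (q : FDist (Fin n)) (g : Fin n → I), p = q.map g ∧ (∀ j, 0 < q.weights j) ∧
      ∀ j, g j ∈ p.weights.support := by
  classical
  let e := p.weights.support.equivFin.symm
  have hinj : Function.Injective fun j => (e j : I) := Subtype.val_injective.comp e.injective
  have hsum : ∑ j, p.weights (e j) = 1 := by
    rw [e.sum_comp fun x => p.weights x.1]
    exact (Finset.sum_coe_sort p.weights.support fun x => p.weights x).trans p.total
  refine ⟨_, ⟨Finsupp.equivFunOnFinite.symm fun j => p.weights (e j), ?_, ?_⟩,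
    fun j => (e j).1, ?_, ?_, fun j => (e j).2⟩
  · intro j
    simp
  · rw [Finsupp.sum_fintype _ _ fun _ => rfl]
    simpa using hsum
  · apply StdSimplex.ext
    ext i
    rw [StdSimplex.weights_map]
    by_cases hi : i ∈ p.weights.support
    · obtain ⟨j, hj⟩ := e.surjective ⟨i, hi⟩
      have hj' : (e j : I) = i := by rw [hj]
      rw [← hj']
      exact (Finsupp.mapDomain_apply (f := fun j => (e j : I)) hinj
        (Finsupp.equivFunOnFinite.symm fun j => p.weights (e j)) j).symm
    · rw [Finsupp.mapDomain_of_notMem_range]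
      · simpa using hi
      · rintro ⟨j, rfl⟩
        exact hi (e j).2
  · intro j
    exact lt_of_le_of_ne (p.weights_nonneg (e j))
      (Ne.symm (Finsupp.mem_support_iff (f := p.weights).1 (e j).2))

/-- Every joint distribution is a mixture of its conditional distributions. -/
theorem exists_disintegration (μ : FDist (S × I)) :
    ∃ κ : S → FDist I, μ = mix (μ.map Prod.fst) fun s => (κ s).map (Prod.mk s) := by
  classical
  have hr : ∀ s, (μ.map Prod.fst).weights s =
      (μ.weights.filter (· ∈ {x : S × I | x.1 = s})).sum fun _ k => k := by
    intro s
    rw [StdSimplex.weights_map, Finsupp.mapDomain, Finsupp.sum_apply, Finsupp.sum_filter_index,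
      Finsupp.support_filter, Finset.sum_filter]
    exact Finset.sum_congr rfl fun x _ => by simp [Finsupp.single_apply]
  have key : ∀ s, ∃ κ : FDist I, s ∈ (μ.map Prod.fst).weights.support →
      (μ.map Prod.fst).weights s • (κ.map (Prod.mk s)).weights =
        μ.weights.filter (· ∈ {x : S × I | x.1 = s}) := by
    intro s
    by_cases hs : s ∈ (μ.map Prod.fst).weights.support
    · obtain ⟨x, hx, hxs⟩ := mem_support_map hs
      have hex : ∃ y ∈ {x : S × I | x.1 = s}, μ.weights y ≠ 0 :=
        ⟨x, hxs, Finsupp.mem_support_iff.1 hx⟩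
      -- The conditional distribution: restrict to the fibre over `s`, normalise, project.
      refine ⟨(μ.restrict _ hex).map Prod.snd, fun _ => ?_⟩
      have : ((μ.restrict _ hex).map Prod.snd).map (Prod.mk s) = μ.restrict _ hex := by
        rw [StdSimplex.map_map]
        conv_rhs => rw [← StdSimplex.map_id (μ.restrict _ hex)]
        refine map_congr fun y hy => ?_
        rw [StdSimplex.support_weights_restrict, Finset.mem_filter] at hy
        exact Prod.ext hy.2.symm rfl
      rw [this, StdSimplex.weights_restrict, ← hr, smul_inv_smul₀ (Finsupp.mem_support_iff.1 hs)]
    · exact ⟨μ.map Prod.snd, fun h => absurd h hs⟩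
  choose κ hκ using key
  refine ⟨κ, StdSimplex.ext ?_⟩
  ext x
  rw [weights_mix, expect, Finsupp.sum, Finset.sum_congr rfl hκ, Finsupp.finsetSum_apply]
  simp only [Finsupp.filter_apply, Set.mem_ofPred_eq]
  rw [Finset.sum_ite_eq]
  split_ifs with h
  · rfl
  · rw [Finsupp.notMem_support_iff, hr] at h
    -- The fibre over a point of marginal weight 0 has nonnegative weights with sum 0, so all of
    -- them vanish.
    by_contra hx
    have hy : ∀ y ∈ (μ.weights.filter (· ∈ {y : S × I | y.1 = x.1})).support,
        0 ≤ μ.weights.filter (· ∈ {y : S × I | y.1 = x.1}) y := fun y hy => by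
      rw [Finsupp.filter_apply]
      split_ifs
      exacts [μ.weights_nonneg y, le_rfl]
    have hxf : μ.weights.filter (· ∈ {y : S × I | y.1 = x.1}) x = μ.weights x :=
      Finsupp.filter_apply_pos _ _ rfl
    have hxs : x ∈ (μ.weights.filter (· ∈ {y : S × I | y.1 = x.1})).support := by
      rw [Finsupp.mem_support_iff, hxf]
      exact hx
    exact hx (hxf.symm.trans ((Finset.sum_eq_zero_iff_of_nonneg hy).1 h x hxs))

/-! ### Sets of expected values -/

theorem mem_expectSet {Δ : FDist S} {F : S → Set X} (hF : ∀ s, (F s).Nonempty) {f : S → X}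
    (hf : ∀ s ∈ Δ.weights.support, f s ∈ F s) : expect Δ f ∈ expectSet Δ F := by
  classical
  refine ⟨fun s => if s ∈ Δ.weights.support then f s else (hF s).some, fun s => ?_,
    expect_congr fun s hs => (if_pos hs).symm⟩
  dsimp only
  split_ifs with h
  · exact hf s h
  · exact (hF s).some_mem

theorem expectSet_nonempty {Δ : FDist S} {F : S → Set X} (hF : ∀ s, (F s).Nonempty) :
    (expectSet Δ F).Nonempty :=
  ⟨_, mem_expectSet hF fun s _ => (hF s).some_mem⟩

theorem expectSet_mono {Δ : FDist S} {F G : S → Set X} (h : ∀ s, F s ⊆ G s) :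
    expectSet Δ F ⊆ expectSet Δ G := by
  rintro _ ⟨f, hf, rfl⟩
  exact ⟨f, fun s => h s (hf s), rfl⟩

theorem expectSet_single {F : S → Set X} (hF : ∀ s, (F s).Nonempty) (s : S) :
    expectSet (StdSimplex.single s) F = F s := by
  classical
  ext x
  constructor
  · rintro ⟨f, hf, rfl⟩
    rw [expect_single]
    exact hf s
  · intro hx
    have := mem_expectSet (Δ := StdSimplex.single s) hF (f := fun _ => x) fun t ht => by
      have := Finsupp.support_single_subset ht
      rw [Finset.mem_singleton.1 this]
      exact hx
    simpa using this

theorem convex_expectSet {Δ : FDist S} {F : S → Set X} (hF : ∀ s, Convex ℝ (F s)) :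
    Convex ℝ (expectSet Δ F) := by
  rintro _ ⟨f, hf, rfl⟩ _ ⟨g, hg, rfl⟩ a b ha hb hab
  exact ⟨fun s => a • f s + b • g s, fun s => hF s (hf s) (hg s) ha hb hab, by
    rw [expect_add, expect_smul, expect_smul]⟩

/-- Choices that are made separately in the components of a mixture can be averaged. -/
theorem expect_mem_expectSet_mix {p : FDist I} {Δ : I → FDist S} {F : S → Set X}
    (hF : ∀ s, Convex ℝ (F s)) {f : I → S → X} (hf : ∀ i s, f i s ∈ F s) :
    (expect p fun i => expect (Δ i) (f i)) ∈ expectSet (mix p Δ) F := by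
  -- A state may lie in several components with different choices. Recording the component and then
  -- conditioning on the state gives the single choice at `s`: the average of the `f i s`, which
  -- convexity keeps in `F s`.
  obtain ⟨κ, hκ⟩ := exists_disintegration (mix p fun i => (Δ i).map fun s => (s, i))
  have h₁ : (mix p fun i => (Δ i).map fun s => (s, i)).map Prod.fst = mix p Δ := by
    simp only [map_mix, StdSimplex.map_map]
    congr
    funext i
    exact StdSimplex.map_id _
  rw [h₁] at hκ
  refine ⟨fun s => expect (κ s) fun i => f i s, fun s => expect_mem (hF s) fun i _ => hf i s, ?_⟩
  have h₂ := congrArg (fun μ => expect μ fun x : S × I => f x.2 x.1) hκ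
  simpa only [expect_mix, expect_map] using h₂

theorem mem_expectSet_mix {p : FDist I} {Δ : I → FDist S} {F : S → Set X}
    (hF : ∀ s, Convex ℝ (F s)) {x : X} :
    x ∈ expectSet (mix p Δ) F ↔ x ∈ expectSet p fun i => expectSet (Δ i) F := by
  constructor
  · rintro ⟨f, hf, rfl⟩
    exact ⟨fun i => expect (Δ i) f, fun i => ⟨f, hf, rfl⟩, expect_mix _ _ _⟩
  · rintro ⟨o, ho, rfl⟩
    choose f hf hfo using ho
    rw [funext hfo]
    exact expect_mem_expectSet_mix hF hf

theorem expectSet_mix {p : FDist I} {Δ : I → FDist S} {F : S → Set X}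
    (hF : ∀ s, Convex ℝ (F s)) :
    expectSet (mix p Δ) F = expectSet p fun i => expectSet (Δ i) F :=
  Set.ext fun _ => mem_expectSet_mix hF

theorem expectSet_map {Δ : FDist S} {g : S → T} {F : T → Set X}
    (hF : ∀ s, Convex ℝ (F s)) (hne : ∀ s, (F s).Nonempty) :
    expectSet (Δ.map g) F = expectSet Δ fun s => F (g s) := by
  rw [map_eq_mix, expectSet_mix hF]
  simp only [expectSet_single hne]

theorem expectSet_comm_subset (Δ : FDist S) (Θ : FDist T) (F : S → T → Set X) :
    expectSet Δ (fun s => expectSet Θ (F s)) ⊆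
      expectSet Θ fun t => expectSet Δ fun s => F s t := by
  rintro _ ⟨o, ho, rfl⟩
  choose f hf hfo using ho
  refine ⟨fun t => expect Δ fun s => f s t, fun t => ⟨fun s => f s t, fun s => hf s t, rfl⟩, ?_⟩
  rw [funext hfo, expect_comm]

theorem expectSet_comm (Δ : FDist S) (Θ : FDist T) (F : S → T → Set X) :
    expectSet Δ (fun s => expectSet Θ (F s)) = expectSet Θ fun t => expectSet Δ fun s => F s t :=
  Set.Subset.antisymm (expectSet_comm_subset Δ Θ F) (expectSet_comm_subset Θ Δ fun t s => F s t)

theorem expectSet_map₂ {Δ : FDist S} {Θ : FDist T} {g : S → T → U} {F : U → Set X}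
    (hF : ∀ s, Convex ℝ (F s)) (hne : ∀ s, (F s).Nonempty) :
    expectSet (map₂ g Δ Θ) F = expectSet Δ fun s => expectSet Θ fun t => F (g s t) := by
  rw [map₂, expectSet_mix hF]
  simp only [expectSet_map hF hne]

theorem mem_expectSet_convexCombPair {a b : ℝ} {ha : 0 ≤ a} {hb : 0 ≤ b} {h : a + b = 1}
    {Δ Θ : FDist S} {F : S → Set X} (hF : ∀ s, Convex ℝ (F s)) {x : X} :
    x ∈ expectSet (convexCombPair a b ha hb h Δ Θ) F ↔
      ∃ y ∈ expectSet Δ F, ∃ z ∈ expectSet Θ F, x = a • y + b • z := by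
  rw [convexCombPair_eq_mix, mem_expectSet_mix hF]
  constructor
  · rintro ⟨f, hf, rfl⟩
    exact ⟨f 0, hf 0, f 1, hf 1, expect_coin ..⟩
  · rintro ⟨y, hy, z, hz, rfl⟩
    refine ⟨![y, z], fun i => ?_, by rw [expect_coin]; rfl⟩
    fin_cases i
    · exact hy
    · exact hz

end FDist

/-! ### Lifted relations -/

section Lift

variable {I S X : Type*} [AddCommGroup X] [Module ℝ X] {R : S → FDist S → Prop}

theorem lift_of_support {p : FDist I} {s : I → S} {Φ : I → FDist S}
    (h : ∀ i ∈ p.weights.support, R (s i) (Φ i)) :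
    Lift R (FDist.mix p fun i => StdSimplex.single (s i)) (FDist.mix p Φ) := by
  obtain ⟨n, q, g, hp, -, hg⟩ := p.exists_fin
  refine ⟨n, q, fun j => s (g j), fun j => Φ (g j), ?_, fun j => h _ (hg j), ?_⟩
  · rw [hp, FDist.mix_map]
  · rw [hp, FDist.mix_map]

theorem lift_single {s : S} {Φ : FDist S} (h : R s Φ) : Lift R (StdSimplex.single s) Φ := by
  simpa using lift_of_support (p := StdSimplex.single ()) (s := fun _ => s) (Φ := fun _ => Φ)
    fun _ _ => h

theorem lift_refl (hR : ∀ s, R s (StdSimplex.single s)) (Δ : FDist S) : Lift R Δ Δ := by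
  simpa using lift_of_support (p := Δ) (s := fun s => s) fun s _ => hR s

theorem lift_mix {p : FDist I} {Δ Θ : I → FDist S}
    (h : ∀ i ∈ p.weights.support, Lift R (Δ i) (Θ i)) :
    Lift R (FDist.mix p Δ) (FDist.mix p Θ) := by
  obtain ⟨m, r, g, hp, -, hg⟩ := p.exists_fin
  have h' := fun j => h (g j) (hg j)
  choose n q s Φ hΔ hs hΘ using h'
  have := lift_of_support (R := R)
    (p := FDist.mix r fun j => (q j).map fun k => (⟨j, k⟩ : Σ j, Fin (n j)))
    (s := fun x => s x.1 x.2) (Φ := fun x => Φ x.1 x.2) fun x _ => hs x.1 x.2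
  simp only [FDist.mix_mix, FDist.mix_map, ← hΔ, ← hΘ] at this
  rwa [hp, FDist.mix_map, FDist.mix_map]

theorem expectSet_subset_of_lift {F G : S → Set X} (hG : ∀ s, Convex ℝ (G s))
    (hne : ∀ s, (G s).Nonempty) (h : ∀ s Φ, R s Φ → FDist.expectSet Φ F ⊆ G s)
    {Δ Θ : FDist S} (hL : Lift R Δ Θ) : FDist.expectSet Θ F ⊆ FDist.expectSet Δ G := by
  obtain ⟨n, p, s, Φ, rfl, hR, rfl⟩ := hL
  rw [FDist.expectSet_mix hG]
  rintro _ ⟨f, hf, rfl⟩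
  rw [FDist.expect_mix]
  refine ⟨fun i => FDist.expect (Φ i) f, fun i => ?_, rfl⟩
  dsimp only
  rw [FDist.expectSet_single hne]
  exact h _ _ (hR i) ⟨f, hf, rfl⟩

end Lift

/-! ### Weak transitions -/

section Weak

variable {Act Ω I : Type*} {Δ Δ' Θ Θ' : FDist (State Act Ω)} {s : State Act Ω}

theorem lift_hatTau_refl (Δ : FDist (State Act Ω)) : Lift HatTau Δ Δ :=
  lift_refl (fun _ => Or.inr rfl) Δ

theorem weakTau_of_step (h : Step s tau Δ) : WeakTau (StdSimplex.single s) Δ :=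
  Relation.ReflTransGen.single (lift_single (Or.inl h))

theorem WeakTau.refl (Δ : FDist (State Act Ω)) : WeakTau Δ Δ := Relation.ReflTransGen.refl

theorem WeakTau.trans {Δ Θ Ξ : FDist (State Act Ω)} (h : WeakTau Δ Θ) (h' : WeakTau Θ Ξ) :
    WeakTau Δ Ξ := Relation.ReflTransGen.trans h h'

/-- The components may need different numbers of steps. They are moved one after the other, while
the rest idle by the reflexive case of `HatTau`. -/
theorem weakTau_mix {p : FDist I} {Δ Θ : I → FDist (State Act Ω)}
    (h : ∀ i ∈ p.weights.support, WeakTau (Δ i) (Θ i)) :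
    WeakTau (FDist.mix p Δ) (FDist.mix p Θ) := by
  classical
  have key : ∀ A : Finset I, A ⊆ p.weights.support →
      WeakTau (FDist.mix p Δ) (FDist.mix p fun i => if i ∈ A then Θ i else Δ i) := by
    intro A
    induction A using Finset.induction_on with
    | empty => intro _; simpa using WeakTau.refl _
    | insert i A hi ih =>
      intro hA
      refine (ih fun j hj => hA (Finset.mem_insert_of_mem hj)).trans ?_
      have hstep : ∀ Φ, WeakTau (Δ i) Φ →
          WeakTau (FDist.mix p fun j => if j ∈ A then Θ j else Δ j)
            (FDist.mix p fun j => if j = i then Φ else if j ∈ A then Θ j else Δ j) := by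
        intro Φ hΦ
        induction hΦ with
        | refl =>
          have : (fun j => if j = i then Δ i else if j ∈ A then Θ j else Δ j) =
              fun j => if j ∈ A then Θ j else Δ j := by
            funext j
            split_ifs with h₁ h₂
            · exact absurd (h₁ ▸ h₂) hi
            · rw [h₁]
            · rfl
            · rfl
          rw [this]
          exact WeakTau.refl _
        | tail _ hL ih =>
          refine Relation.ReflTransGen.tail ih (lift_mix fun j _ => ?_)
          by_cases hj : j = i
          · simpa only [hj, if_true] using hL
          · simpa only [hj, if_false] using lift_hatTau_refl _
      have := hstep (Θ i) (h i (hA (Finset.mem_insert_self i A)))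
      convert this using 3 with j
      by_cases hj : j = i
      · simp [hj]
      · simp [hj]
  convert key _ (Finset.Subset.refl _) using 1
  exact FDist.mix_congr fun i hi => by rw [if_pos hi]

theorem weakVis_mix {a : Act} {p : FDist I}
    {Δ Θ : I → FDist (State Act Ω)} (h : ∀ i, WeakVis a (Δ i) (Θ i)) :
    WeakVis a (FDist.mix p Δ) (FDist.mix p Θ) := by
  choose Φ Ψ h₁ h₂ h₃ using h
  exact ⟨_, _, weakTau_mix fun i _ => h₁ i, lift_mix fun i _ => h₂ i,
    weakTau_mix fun i _ => h₃ i⟩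

theorem WeakTau.trans_weakVis {a : Act} (h : WeakTau Δ Δ') (h' : WeakVis a Δ' Θ) :
    WeakVis a Δ Θ := by
  obtain ⟨Φ, Ψ, h₁, h₂, h₃⟩ := h'
  exact ⟨Φ, Ψ, h.trans h₁, h₂, h₃⟩

end Weak

/-! ### Processes as terms over the larger set of actions -/

section Embed

variable {Act Ω : Type*}

/-- A transition label of a process as a label over the larger set of actions. -/
def embedLabel : Label Act Empty → Label Act Ω := Option.map (Sum.map id Empty.elim)

theorem embedLabel_eq_vis {α : Label Act Empty} {a : Act} :
    (embedLabel α : Label Act Ω) = vis a ↔ α = vis a := by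
  rcases α with _ | _ | x
  · simp [embedLabel]
  · simp [embedLabel]
  · exact x.elim

theorem embedLabel_eq_tau {α : Label Act Empty} : (embedLabel α : Label Act Ω) = tau ↔ α = tau := by
  simp [embedLabel]

theorem den_embed : ∀ P : Proc Act Empty, (P.embed : Proc Act Ω).den = P.den.map State.embed
  | .state s => by simp [Proc.embed, Proc.den]
  | .prob p P Q => by
    rw [Proc.embed, Proc.den, Proc.den, den_embed P, den_embed Q]
    simp only [FDist.convexCombPair_eq_mix, FDist.map_mix]
    congr
    funext i
    fin_cases i <;> rfl

theorem den_parState (A : Set Act) (s : State Act Ω) :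
    ∀ Q : Proc Act Ω, (Proc.parState A s Q).den = Q.den.map (.par A s)
  | .state t => by simp [Proc.parState, Proc.den]
  | .prob p P Q => by
    rw [Proc.parState, Proc.den, Proc.den, den_parState A s P, den_parState A s Q]
    simp only [FDist.convexCombPair_eq_mix, FDist.map_mix]
    congr
    funext i
    fin_cases i <;> rfl

theorem den_par (A : Set Act) (R : Proc Act Ω) :
    ∀ P : Proc Act Ω, (Proc.par A P R).den = FDist.map₂ (.par A) P.den R.den
  | .state s => by simp [Proc.par, Proc.den, den_parState, FDist.map₂]
  | .prob p P Q => by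
    rw [Proc.par, Proc.den, Proc.den, den_par A R P, den_par A R Q]
    simp only [FDist.convexCombPair_eq_mix, FDist.map₂, FDist.mix_mix]
    congr
    funext i
    fin_cases i <;> rfl

theorem Step.embed {s : State Act Empty} {α : Label Act Empty} {Δ : FDist (State Act Empty)}
    (h : Step s α Δ) : Step (s.embed : State Act Ω) (embedLabel α) (Δ.map State.embed) := by
  induction h with
  | action x P => rw [← den_embed]; exact .action _ _
  | int_l P Q => rw [← den_embed]; exact .int_l _ _
  | int_r P Q => rw [← den_embed]; exact .int_r _ _
  | ext_l _ ih => exact .ext_l ih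
  | ext_r _ ih => exact .ext_r ih
  | @ext_i_l s₁ s₂ _ _ ih =>
    have := Step.ext_i_l (s₂ := s₂.embed) ih
    rw [StdSimplex.map_map] at this ⊢
    exact this
  | @ext_i_r s₁ s₂ _ _ ih =>
    have := Step.ext_i_r (s₁ := s₁.embed) ih
    rw [StdSimplex.map_map] at this ⊢
    exact this
  | @par_l _ s₁ s₂ _ _ _ hα ih =>
    have := Step.par_l (s₂ := s₂.embed) ih fun a ha h => hα a ha (embedLabel_eq_vis.1 h)
    rw [StdSimplex.map_map] at this ⊢
    exact this
  | @par_r _ s₁ s₂ _ _ _ hα ih =>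
    have := Step.par_r (s₁ := s₁.embed) ih fun a ha h => hα a ha (embedLabel_eq_vis.1 h)
    rw [StdSimplex.map_map] at this ⊢
    exact this
  | par_i _ _ ha ih₁ ih₂ =>
    have := Step.par_i ih₁ ih₂ ha
    simp only [FDist.map₂, FDist.mix_map, FDist.map_mix, StdSimplex.map_map] at this ⊢
    exact this

/-- The converse of `Step.embed`: embedding creates no new transitions. The source is a variable
with an equation so that induction on the transition applies. -/
theorem exists_step_of_step_embed {u : State Act Ω} {α : Label Act Ω} {Θ : FDist (State Act Ω)}
    (h : Step u α Θ) : ∀ s : State Act Empty, u = s.embed →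
      ∃ β Δ, Step s β Δ ∧ α = embedLabel β ∧ Θ = Δ.map State.embed := by
  induction h with
  | action x P =>
    rintro (_ | ⟨y, Q⟩ | _ | _ | _) hs <;> simp only [State.embed, reduceCtorEq] at hs
    obtain ⟨rfl, rfl⟩ := State.pre.inj hs
    exact ⟨_, _, .action y Q, rfl, den_embed Q⟩
  | int_l P Q =>
    rintro (_ | _ | ⟨P', Q'⟩ | _ | _) hs <;> simp only [State.embed, reduceCtorEq] at hs
    obtain ⟨rfl, rfl⟩ := State.int.inj hs
    exact ⟨_, _, .int_l P' Q', rfl, den_embed P'⟩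
  | int_r P Q =>
    rintro (_ | _ | ⟨P', Q'⟩ | _ | _) hs <;> simp only [State.embed, reduceCtorEq] at hs
    obtain ⟨rfl, rfl⟩ := State.int.inj hs
    exact ⟨_, _, .int_r P' Q', rfl, den_embed Q'⟩
  | ext_l _ ih =>
    rintro (_ | _ | _ | ⟨s, t⟩ | _) hs <;> simp only [State.embed, reduceCtorEq] at hs
    obtain ⟨rfl, rfl⟩ := State.ext.inj hs
    obtain ⟨_ | y, Δ, h, hα, hΘ⟩ := ih s rfl
    · cases hα
    · exact ⟨_, Δ, .ext_l h, hα, hΘ⟩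
  | ext_r _ ih =>
    rintro (_ | _ | _ | ⟨s, t⟩ | _) hs <;> simp only [State.embed, reduceCtorEq] at hs
    obtain ⟨rfl, rfl⟩ := State.ext.inj hs
    obtain ⟨_ | y, Δ, h, hα, hΘ⟩ := ih t rfl
    · cases hα
    · exact ⟨_, Δ, .ext_r h, hα, hΘ⟩
  | ext_i_l _ ih =>
    rintro (_ | _ | _ | ⟨s, t⟩ | _) hs <;> simp only [State.embed, reduceCtorEq] at hs
    obtain ⟨rfl, rfl⟩ := State.ext.inj hs
    obtain ⟨β, Δ, h, hα, rfl⟩ := ih s rfl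
    obtain rfl := embedLabel_eq_tau.1 hα.symm
    exact ⟨_, _, .ext_i_l h, rfl, by simp only [StdSimplex.map_map, State.embed]⟩
  | ext_i_r _ ih =>
    rintro (_ | _ | _ | ⟨s, t⟩ | _) hs <;> simp only [State.embed, reduceCtorEq] at hs
    obtain ⟨rfl, rfl⟩ := State.ext.inj hs
    obtain ⟨β, Δ, h, hα, rfl⟩ := ih t rfl
    obtain rfl := embedLabel_eq_tau.1 hα.symm
    exact ⟨_, _, .ext_i_r h, rfl, by simp only [StdSimplex.map_map, State.embed]⟩
  | par_l _ hA ih =>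
    rintro (_ | _ | _ | _ | ⟨A, s, t⟩) hs <;> simp only [State.embed, reduceCtorEq] at hs
    obtain ⟨rfl, rfl, rfl⟩ := State.par.inj hs
    obtain ⟨β, Δ, h, rfl, rfl⟩ := ih s rfl
    exact ⟨_, _, .par_l h fun a ha hβ => hA a ha (embedLabel_eq_vis.2 hβ), rfl,
      by simp only [StdSimplex.map_map, State.embed]⟩
  | par_r _ hA ih =>
    rintro (_ | _ | _ | _ | ⟨A, s, t⟩) hs <;> simp only [State.embed, reduceCtorEq] at hs
    obtain ⟨rfl, rfl, rfl⟩ := State.par.inj hs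
    obtain ⟨β, Δ, h, rfl, rfl⟩ := ih t rfl
    exact ⟨_, _, .par_r h fun a ha hβ => hA a ha (embedLabel_eq_vis.2 hβ), rfl,
      by simp only [StdSimplex.map_map, State.embed]⟩
  | par_i _ _ ha ih₁ ih₂ =>
    rintro (_ | _ | _ | _ | ⟨A, s, t⟩) hs <;> simp only [State.embed, reduceCtorEq] at hs
    obtain ⟨rfl, rfl, rfl⟩ := State.par.inj hs
    obtain ⟨β, Δ, h, hβ, rfl⟩ := ih₁ s rfl
    obtain ⟨γ, Δ', h', hγ, rfl⟩ := ih₂ t rfl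
    obtain rfl := embedLabel_eq_vis.1 hβ.symm
    obtain rfl := embedLabel_eq_vis.1 hγ.symm
    exact ⟨_, _, .par_i h h' ha, rfl, by
      simp only [FDist.map₂, FDist.mix_map, FDist.map_mix, StdSimplex.map_map, State.embed]⟩

end Embed

section

variable {Act Ω : Type*}

/-! ### Results -/

@[simp]
theorem bang_tau (o : Ω → ℝ) : bang (tau : Label Act Ω) o = o := by
  funext ω
  simp [bang]

theorem convex_results (s : State Act Ω) : Convex ℝ (results s) := by
  classical
  rw [results_eq]
  split_ifs
  · exact convex_convexHull ℝ _
  · exact convex_singleton 0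

theorem bang_mem_results {s : State Act Ω} {α : Label Act Ω} {Δ : FDist (State Act Ω)}
    {o : Ω → ℝ} (h : Step s α Δ) (ho : o ∈ resultsDist Δ) : bang α o ∈ results s := by
  classical
  rw [results_eq, if_pos ⟨α, Δ, h⟩]
  refine subset_convexHull ℝ _ ?_
  simp only [Set.mem_iUnion]
  exact ⟨α, Δ, h, o, ho, rfl⟩

theorem zero_mem_results {s : State Act Ω} (h : ∀ α Δ, ¬ Step s α Δ) :
    (0 : Ω → ℝ) ∈ results s := by
  classical
  rw [results_eq, if_neg fun ⟨α, Δ, h'⟩ => h α Δ h']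
  rfl

/-- The results of applying a state-based test to a state. -/
def outcomesState (t : State Act Ω) (s : PureState Act) : Set (Ω → ℝ) :=
  results (.par Set.univ t s.embed)

theorem convex_outcomesState (t : State Act Ω) (s : PureState Act) :
    Convex ℝ (outcomesState t s) := convex_results _

theorem outcomesState_nonempty (t : State Act Ω) (s : PureState Act) :
    (outcomesState t s).Nonempty := results_nonempty _

theorem outcomes_eq (T : OmegaTest Act Ω) (P : PureProc Act) :
    outcomes T P = FDist.expectSet T.den fun t => FDist.expectSet P.den (outcomesState t) := by
  rw [outcomes, resultsDist, den_par, FDist.expectSet_map₂ convex_results results_nonempty,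
    den_embed]
  congr
  funext t
  rw [FDist.expectSet_map (fun u => convex_results _) (fun u => results_nonempty _)]
  rfl

theorem outcomes_state (T : OmegaTest Act Ω) (s : PureState Act) :
    outcomes T (.state s) = FDist.expectSet T.den fun t => outcomesState t s := by
  rw [outcomes_eq]
  simp only [Proc.den, FDist.expectSet_single (outcomesState_nonempty _)]

theorem outcomesDist_eq (T : OmegaTest Act Ω) (Δ : FDist (PureState Act)) :
    outcomesDist T Δ = FDist.expectSet T.den fun t => FDist.expectSet Δ (outcomesState t) := by
  rw [outcomesDist, FDist.expectSet_comm]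
  simp only [outcomes_state]

theorem outcomesDist_den (T : OmegaTest Act Ω) (P : PureProc Act) :
    outcomesDist T P.den = outcomes T P := by
  rw [outcomesDist_eq, outcomes_eq]

theorem convex_outcomes (T : OmegaTest Act Ω) (P : PureProc Act) : Convex ℝ (outcomes T P) :=
  FDist.convex_expectSet fun _ => convex_results _

theorem outcomes_nonempty (T : OmegaTest Act Ω) (P : PureProc Act) : (outcomes T P).Nonempty :=
  FDist.expectSet_nonempty fun _ => results_nonempty _

theorem outcomesDist_single (T : OmegaTest Act Ω) (s : PureState Act) :
    outcomesDist T (StdSimplex.single s) = outcomes T (.state s) :=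
  FDist.expectSet_single (fun _ => outcomes_nonempty _ _) s

theorem outcomesDist_state (t : State Act Ω) (Δ : FDist (PureState Act)) :
    outcomesDist (.state t) Δ = FDist.expectSet Δ (outcomesState t) := by
  rw [outcomesDist_eq, Proc.den,
    FDist.expectSet_single fun t => FDist.expectSet_nonempty (outcomesState_nonempty t)]

theorem mem_outcomesDist_prob {p : Set.Ioo (0 : ℝ) 1} {T T' : OmegaTest Act Ω}
    {Δ : FDist (PureState Act)} {o : Ω → ℝ} :
    o ∈ outcomesDist (.prob p T T') Δ ↔
      ∃ o₁ ∈ outcomesDist T Δ, ∃ o₂ ∈ outcomesDist T' Δ, o = p.1 • o₁ + (1 - p.1) • o₂ := by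
  rw [outcomesDist_eq, outcomesDist_eq, outcomesDist_eq, Proc.den,
    FDist.mem_expectSet_convexCombPair fun t => FDist.convex_expectSet (convex_outcomesState t)]

/-! ### Transitions of a test applied to a state -/

theorem bang_mem_outcomesState {t : State Act Ω} {s : PureState Act} {α : Label Act Ω}
    {Γ : FDist (State Act Ω)} {o : Ω → ℝ} (h : Step t α Γ) (hα : ∀ a, α ≠ vis a)
    (ho : o ∈ FDist.expectSet Γ fun t' => outcomesState t' s) :
    bang α o ∈ outcomesState t s := by
  refine bang_mem_results (.par_l h fun a _ => hα a) ?_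
  rwa [resultsDist, FDist.expectSet_map convex_results results_nonempty]

theorem expectSet_subset_outcomesState_of_tau {t : State Act Ω} {s : PureState Act}
    {Δ : FDist (PureState Act)} (h : Step s tau Δ) :
    FDist.expectSet Δ (outcomesState t) ⊆ outcomesState t s := by
  intro o ho
  have h' := Step.par_r (A := Set.univ) (s₁ := t) h.embed fun a _ h => by
    simpa using embedLabel_eq_vis.1 h
  have := bang_mem_results (o := o) h' (by
    rwa [resultsDist, StdSimplex.map_map, FDist.expectSet_map convex_results results_nonempty])
  rwa [embedLabel_eq_tau.2 rfl, bang_tau] at this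

theorem outcomesDist_subset_outcomesState_of_sync {t : State Act Ω} {s : PureState Act} {a : Act}
    {T : OmegaTest Act Ω} {Δ : FDist (PureState Act)} (ht : Step t (vis a) T.den)
    (hs : Step s (vis a) Δ) : outcomesDist T Δ ⊆ outcomesState t s := by
  intro o ho
  have hs' := hs.embed (Ω := Ω)
  rw [embedLabel_eq_vis.2 rfl] at hs'
  have := bang_mem_results (o := o) (.par_i ht hs' (Set.mem_univ a)) (by
    rw [resultsDist, FDist.expectSet_map₂ convex_results results_nonempty]
    simp only [FDist.expectSet_map (fun u => convex_results _) fun u => results_nonempty _]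
    rwa [outcomesDist_eq] at ho)
  rwa [bang_tau] at this

/-- Under synchronisation on all of `Act`, only three moves remain: a non-visible move of the test,
an internal move of the process, or a handshake. -/
theorem exists_step_of_step_par {t : State Act Ω} {s : PureState Act} {α : Label Act Ω}
    {Ξ : FDist (State Act Ω)} (h : Step (.par Set.univ t s.embed) α Ξ) :
    (∃ Γ, Step t α Γ ∧ (∀ a, α ≠ vis a) ∧ Ξ = Γ.map fun t' => .par Set.univ t' s.embed) ∨
    (∃ Δ, Step s tau Δ ∧ α = tau ∧ Ξ = Δ.map fun s' => .par Set.univ t s'.embed) ∨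
    ∃ a Γ Δ, Step t (vis a) Γ ∧ Step s (vis a) Δ ∧ α = tau ∧
      Ξ = FDist.map₂ (.par Set.univ) Γ (Δ.map State.embed) := by
  cases h with
  | par_l h hα => exact Or.inl ⟨_, h, fun a => hα a (Set.mem_univ a), rfl⟩
  | par_r h hα =>
    obtain ⟨β, Δ, hβ, rfl, rfl⟩ := exists_step_of_step_embed h s rfl
    rcases β with _ | a | x
    · exact Or.inr (Or.inl ⟨Δ, hβ, rfl, StdSimplex.map_map _ _ _⟩)
    · exact absurd (embedLabel_eq_vis.2 rfl) (hα a (Set.mem_univ a))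
    · exact x.elim
  | par_i h h' _ =>
    obtain ⟨β, Δ, hβ, hα, rfl⟩ := exists_step_of_step_embed h' s rfl
    obtain rfl := embedLabel_eq_vis.1 hα.symm
    exact Or.inr (Or.inr ⟨_, _, Δ, h, hβ, rfl, rfl⟩)

theorem zero_mem_outcomesState {t : State Act Ω} {s : PureState Act}
    (ht : ∀ α Γ, Step t α Γ → ∃ a, α = vis a ∧ ∀ Δ, ¬ Step s (vis a) Δ)
    (hs : ∀ Δ, ¬ Step s tau Δ) : (0 : Ω → ℝ) ∈ outcomesState t s := by
  refine zero_mem_results fun α Ξ h => ?_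
  rcases exists_step_of_step_par h with ⟨Γ, h, hα, -⟩ | ⟨Δ, h, -⟩ | ⟨a, Γ, Δ, h, h', -⟩
  · obtain ⟨a, ha, -⟩ := ht _ _ h
    exact hα a ha
  · exact hs Δ h
  · obtain ⟨b, hb, hbs⟩ := ht _ _ h
    obtain rfl : a = b := by simpa using hb
    exact hbs Δ h'

/-- Internal moves of the process are also moves of the composite and leave the test untouched, so
whatever is obtainable after them is obtainable before. -/
theorem outcomesDist_subset_of_weakTau {Δ Δ' : FDist (PureState Act)} (T : OmegaTest Act Ω)
    (h : WeakTau Δ Δ') : outcomesDist T Δ' ⊆ outcomesDist T Δ := by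
  rw [outcomesDist_eq, outcomesDist_eq]
  refine FDist.expectSet_mono fun t => ?_
  induction h with
  | refl => exact Set.Subset.rfl
  | tail _ hL ih =>
    refine Set.Subset.trans ?_ ih
    refine expectSet_subset_of_lift (convex_outcomesState t) (outcomesState_nonempty t) ?_ hL
    rintro s Φ (h | rfl)
    · exact expectSet_subset_outcomesState_of_tau h
    · rw [FDist.expectSet_single (outcomesState_nonempty t)]

/-! ### Upper bounds for the outcomes of a test -/

/-- A family of sets indexed by distributions is compatible with convex combinations. -/
def ConvexFamily {S X : Type*} [AddCommGroup X] [Module ℝ X] (W : FDist S → Set X) : Prop :=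
  ∀ (n : ℕ) (q : FDist (Fin n)), (∀ i, 0 < q.weights i) →
    ∀ (Δ : Fin n → FDist S) (o : Fin n → X), (∀ i, o i ∈ W (Δ i)) →
      FDist.expect q o ∈ W (FDist.mix q Δ)

section ConvexFamily

variable {I S X : Type*} [AddCommGroup X] [Module ℝ X] {W : FDist S → Set X}

theorem ConvexFamily.expect_mem (hW : ConvexFamily W) {p : FDist I} {Δ : I → FDist S} {o : I → X}
    (h : ∀ i ∈ p.weights.support, o i ∈ W (Δ i)) : FDist.expect p o ∈ W (FDist.mix p Δ) := by
  obtain ⟨n, q, g, hp, hq, hg⟩ := p.exists_fin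
  have := hW n q hq (fun j => Δ (g j)) (fun j => o (g j)) fun j => h _ (hg j)
  rwa [hp, FDist.expect_map, FDist.mix_map]

theorem ConvexFamily.convex (hW : ConvexFamily W) (Δ : FDist S) : Convex ℝ (W Δ) := by
  intro x hx y hy a b ha hb hab
  have := hW.expect_mem (p := FDist.coin a b ha hb hab) (Δ := fun _ => Δ) (o := ![x, y])
    fun i _ => by fin_cases i <;> assumption
  simpa [FDist.expect_coin] using this

theorem convexFamily_const {C : Set X} (hC : Convex ℝ C) :
    ConvexFamily fun _ : FDist S => C :=
  fun _ _ _ _ _ ho => FDist.expect_mem hC fun i _ => ho i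

end ConvexFamily

/-- The test is fixed and the induction is on the size of the process. The induction hypothesis is
needed only for internal moves of the process; moves that change the test, and deadlock, are left to
the hypotheses on `W`. -/
theorem expectSet_outcomesState_subset {t : State Act Ω}
    {W : FDist (PureState Act) → Set (Ω → ℝ)} (hW : ConvexFamily W)
    (htau : ∀ s Δ, Step s tau Δ → W Δ ⊆ W (StdSimplex.single s))
    (htest : ∀ s α Γ o, Step t α Γ → (∀ a, α ≠ vis a) →
      (o ∈ FDist.expectSet Γ fun t' => outcomesState t' s) → bang α o ∈ W (StdSimplex.single s))
    (hsync : ∀ s a Γ Δ, Step t (vis a) Γ → Step s (vis a) Δ →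
      (FDist.expectSet Γ fun t' => FDist.expectSet Δ (outcomesState t')) ⊆
        W (StdSimplex.single s))
    (hdead : ∀ s, (∀ α Γ, Step t α Γ → ∃ a, α = vis a ∧ ∀ Δ, ¬ Step s (vis a) Δ) →
      (∀ Δ, ¬ Step s tau Δ) → (0 : Ω → ℝ) ∈ W (StdSimplex.single s))
    (Δ : FDist (PureState Act)) : FDist.expectSet Δ (outcomesState t) ⊆ W Δ := by
  classical
  have key : ∀ n, ∀ s : PureState Act, s.size = n → outcomesState t s ⊆ W (StdSimplex.single s) := by
    intro n
    induction n using Nat.strong_induction_on with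
    | _ n ih =>
      rintro s rfl
      rw [outcomesState, results_eq]
      split_ifs with hex
      · refine convexHull_min ?_ (hW.convex _)
        simp only [Set.iUnion_subset_iff]
        rintro α Ξ hstep _ ⟨o, ho, rfl⟩
        rcases exists_step_of_step_par hstep with ⟨Γ, h, hα, rfl⟩ | ⟨Δ, h, rfl, rfl⟩ |
          ⟨a, Γ, Δ, h, h', rfl, rfl⟩
        · rw [resultsDist, FDist.expectSet_map convex_results results_nonempty] at ho
          exact htest s α Γ o h hα ho
        · rw [resultsDist, FDist.expectSet_map convex_results results_nonempty] at ho
          rw [bang_tau]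
          refine htau s Δ h ?_
          obtain ⟨f, hf, rfl⟩ := ho
          have := hW.expect_mem (p := Δ) (Δ := fun s' => StdSimplex.single s') (o := f)
            fun s' hs' => ih _ (h.size_lt s' hs') s' rfl (hf s')
          rwa [FDist.mix_single_right] at this
        · rw [resultsDist, FDist.expectSet_map₂ convex_results results_nonempty] at ho
          simp only [FDist.expectSet_map (fun u => convex_results _) fun u => results_nonempty _]
            at ho
          rw [bang_tau]
          exact hsync s a Γ Δ h h' ho
      · rintro _ rfl
        refine hdead s (fun α Γ h => ?_) fun Δ h => ?_
        · by_cases hα : ∃ a, α = vis a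
          · obtain ⟨a, rfl⟩ := hα
            refine ⟨a, rfl, fun Δ h' => hex ?_⟩
            have := h'.embed (Ω := Ω)
            rw [embedLabel_eq_vis.2 rfl] at this
            exact ⟨_, _, .par_i h this (Set.mem_univ a)⟩
          · exact absurd ⟨_, _, .par_l h fun a _ h' => hα ⟨a, h'⟩⟩ hex
        · exact hex ⟨_, _, .par_r h.embed fun a _ h => by simpa using embedLabel_eq_vis.1 h⟩
  rintro _ ⟨f, hf, rfl⟩
  have := hW.expect_mem (p := Δ) (Δ := fun s' => StdSimplex.single s') (o := f)
    fun s _ => key _ s rfl (hf s)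
  rwa [FDist.mix_single_right] at this

end

section

variable {Act Ω : Type*}

/-! ### Sub-unit tuples -/

/-- The tuple whose only nonzero component is a `1` at `ω`. -/
def point (ω : Ω) : Ω → ℝ := Set.indicator {ω} 1

@[simp]
theorem point_self (ω : Ω) : point ω ω = 1 := by simp [point]

theorem point_of_ne {ω ω' : Ω} (h : ω' ≠ ω) : point ω ω' = 0 := by simp [point, h]

theorem point_nonneg (ω ω' : Ω) : 0 ≤ point ω ω' :=
  Set.indicator_nonneg (fun _ _ => zero_le_one) ω'

theorem bang_succ_zero (ω : Ω) : bang (succ ω : Label Act Ω) 0 = point ω := by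
  funext ω'
  by_cases h : ω' = ω <;> simp [bang, point, h]

theorem hasSum_point (ω : Ω) : HasSum (point ω) 1 := by
  have := hasSum_single (f := point ω) ω fun ω' h => point_of_ne h
  rwa [point_self] at this

/-- The nonnegative tuples supported in `U` whose finite partial sums are at most `1`. -/
def subUnit (U : Set Ω) : Set (Ω → ℝ) :=
  {o | (∀ ω, 0 ≤ o ω) ∧ (∀ ω ∉ U, o ω = 0) ∧ ∀ G : Finset Ω, ∑ ω ∈ G, o ω ≤ 1}

theorem convex_subUnit (U : Set Ω) : Convex ℝ (subUnit U) := by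
  rintro x ⟨hx₁, hx₂, hx₃⟩ y ⟨hy₁, hy₂, hy₃⟩ a b ha hb hab
  refine ⟨fun ω => ?_, fun ω hω => ?_, fun G => ?_⟩
  · exact add_nonneg (mul_nonneg ha (hx₁ ω)) (mul_nonneg hb (hy₁ ω))
  · simp [hx₂ ω hω, hy₂ ω hω]
  · simp only [Pi.add_apply, Pi.smul_apply, smul_eq_mul, Finset.sum_add_distrib,
      ← Finset.mul_sum]
    calc a * ∑ ω ∈ G, x ω + b * ∑ ω ∈ G, y ω ≤ a * 1 + b * 1 :=
          add_le_add (mul_le_mul_of_nonneg_left (hx₃ G) ha) (mul_le_mul_of_nonneg_left (hy₃ G) hb)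
      _ = 1 := by rw [mul_one, mul_one, hab]

theorem subUnit_mono {U V : Set Ω} (h : U ⊆ V) : subUnit U ⊆ subUnit V :=
  fun _ ho => ⟨ho.1, fun ω hω => ho.2.1 ω fun h' => hω (h h'), ho.2.2⟩

theorem zero_mem_subUnit (U : Set Ω) : (0 : Ω → ℝ) ∈ subUnit U :=
  ⟨fun _ => le_rfl, fun _ _ => rfl, fun G => by simp⟩

theorem point_mem_subUnit {U : Set Ω} {ω : Ω} (h : ω ∈ U) : point ω ∈ subUnit U :=
  ⟨point_nonneg ω, fun _ h' => point_of_ne fun h'' => h' (h'' ▸ h),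
    fun G => sum_le_hasSum G (fun _ _ => point_nonneg ω _) (hasSum_point ω)⟩

theorem le_one_of_mem_subUnit {U : Set Ω} {o : Ω → ℝ} (h : o ∈ subUnit U) (ω : Ω) : o ω ≤ 1 := by
  simpa using h.2.2 {ω}

/-- The tuple `v` already exhausts the total mass 1, so nothing is left by which `o` could exceed
it. -/
theorem eq_of_le_of_mem_subUnit {U : Set Ω} {o v : Ω → ℝ} (h : o ∈ subUnit U) (hv : HasSum v 1)
    (hle : v ≤ o) : o = v := by
  have ho : HasSum o (∑' ω, o ω) := (summable_of_sum_le h.1 h.2.2).hasSum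
  have ho1 : ∑' ω, o ω ≤ 1 := (summable_of_sum_le h.1 h.2.2).tsum_le_of_sum_le h.2.2
  by_contra hne
  have hlt : v < o := lt_of_le_of_ne hle fun h => hne h.symm
  obtain ⟨ω, hω⟩ := (Pi.lt_def.1 hlt).2
  exact absurd (hasSum_lt hle hω hv ho) (not_lt.2 ho1)

/-! ### The test that succeeds immediately -/

/-- The test that performs `ω` and stops. -/
def successTest (ω : Ω) : State Act Ω := .pre (Sum.inr ω) (.state .nil)

theorem outcomesState_nil (s : PureState Act) : outcomesState (.nil : State Act Ω) s ⊆ {0} := by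
  have := expectSet_outcomesState_subset (t := (.nil : State Act Ω))
    (convexFamily_const (convex_singleton (0 : Ω → ℝ))) (fun _ _ _ => Set.Subset.rfl)
    (fun _ _ _ _ h => by cases h) (fun _ _ _ _ h => by cases h) (fun _ _ _ => rfl)
    (StdSimplex.single s)
  rwa [FDist.expectSet_single (outcomesState_nonempty _)] at this

theorem outcomesState_successTest (ω : Ω) (s : PureState Act) :
    outcomesState (successTest ω : State Act Ω) s = {point ω} := by
  refine (Set.Nonempty.subset_singleton_iff (outcomesState_nonempty _ s)).1 ?_
  have := expectSet_outcomesState_subset (t := (successTest ω : State Act Ω))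
    (convexFamily_const (convex_singleton (point ω))) (fun _ _ _ => Set.Subset.rfl)
    (fun s α Γ o h _ ho => ?_) (fun _ _ _ _ h => by cases h) (fun s h => ?_)
    (StdSimplex.single s)
  · rwa [FDist.expectSet_single (outcomesState_nonempty _)] at this
  · cases h with
    | action x P =>
      rw [Proc.den, FDist.expectSet_single fun t => outcomesState_nonempty t s] at ho
      obtain rfl : o = 0 := outcomesState_nil s ho
      exact bang_succ_zero ω
  · obtain ⟨a, ha, -⟩ := h _ _ (.action _ _)
    simp at ha

theorem outcomes_successTest (ω : Ω) (s : PureState Act) :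
    outcomes (.state (successTest ω) : OmegaTest Act Ω) (.state s) = {point ω} := by
  rw [outcomes_state, Proc.den, FDist.expectSet_single fun t => outcomesState_nonempty t s,
    outcomesState_successTest]

theorem outcomesDist_successTest (ω : Ω) (Δ : FDist (PureState Act)) :
    outcomesDist (.state (successTest ω) : OmegaTest Act Ω) Δ = {point ω} := by
  rw [outcomesDist]
  simp only [outcomes_successTest]
  ext o
  constructor
  · rintro ⟨f, hf, rfl⟩
    rw [FDist.expect_congr (g := fun _ => point ω) fun s _ => hf s, FDist.expect_const]
    rfl
  · rintro rfl
    exact ⟨fun _ => point ω, fun _ => rfl, (FDist.expect_const _ _).symm⟩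

/-! ### Characteristic tests -/

/-- The outcomes of `T` all lie in `subUnit U`, and those below `v` characterise the property `K` of
distributions. -/
structure Characterises (K : FDist (PureState Act) → Prop) (T : OmegaTest Act Ω) (v : Ω → ℝ)
    (U : Set Ω) : Prop where
  mem_outcomes : ∀ Δ, K Δ → v ∈ outcomesDist T Δ
  of_le : ∀ Δ, ∀ o ∈ outcomesDist T Δ, o ≤ v → K Δ
  outcomes_subset : ∀ Δ, outcomesDist T Δ ⊆ subUnit U
  mem_subUnit : v ∈ subUnit U

theorem Characterises.mono {K : FDist (PureState Act) → Prop} {T : OmegaTest Act Ω} {v : Ω → ℝ}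
    {U V : Set Ω} (h : Characterises K T v U) (hUV : U ⊆ V) : Characterises K T v V :=
  ⟨h.mem_outcomes, h.of_le, fun Δ => (h.outcomes_subset Δ).trans (subUnit_mono hUV),
    subUnit_mono hUV h.mem_subUnit⟩

theorem Characterises.congr {K K' : FDist (PureState Act) → Prop} {T : OmegaTest Act Ω}
    {v : Ω → ℝ} {U : Set Ω} (h : Characterises K T v U) (hK : ∀ Δ, K Δ ↔ K' Δ) :
    Characterises K' T v U :=
  ⟨fun Δ hΔ => h.mem_outcomes Δ ((hK Δ).2 hΔ), fun Δ o ho hle => (hK Δ).1 (h.of_le Δ o ho hle),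
    h.outcomes_subset, h.mem_subUnit⟩

/-- The case of the empty conjunction. A test with tuple 0 would not do, since the total has to be
1. -/
theorem characterises_true (ω : Ω) :
    Characterises (fun _ : FDist (PureState Act) => True) (.state (successTest ω)) (point ω)
      {ω} where
  mem_outcomes Δ _ := by rw [outcomesDist_successTest]; rfl
  of_le _ _ _ _ := trivial
  outcomes_subset Δ := by
    rw [outcomesDist_successTest, Set.singleton_subset_iff]
    exact point_mem_subUnit rfl
  mem_subUnit := point_mem_subUnit rfl

/-- The probability `1 / 2` as a parameter of probabilistic choice. -/
def half : Set.Ioo (0 : ℝ) 1 := ⟨1 / 2, by norm_num, by norm_num⟩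

theorem half_add_half_mem_subUnit {U : Set Ω} {x y : Ω → ℝ} (hx : x ∈ subUnit U)
    (hy : y ∈ subUnit U) : half.1 • x + (1 - half.1) • y ∈ subUnit U :=
  convex_subUnit U hx hy half.2.1.le (sub_nonneg.2 half.2.2.le) (add_sub_cancel _ _)

theorem hasSum_half_add_half {x y : Ω → ℝ} (hx : HasSum x 1) (hy : HasSum y 1) :
    HasSum (half.1 • x + (1 - half.1) • y) 1 := by
  have := (hx.mul_left half.1).add (hy.mul_left (1 - half.1))
  rwa [mul_one, mul_one, add_sub_cancel] at this

/-- Since the supports are disjoint, each coordinate of the average is half a coordinate of one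
component, so the inequality can be read off separately for the two tests. -/
theorem Characterises.and {K K' : FDist (PureState Act) → Prop} {T T' : OmegaTest Act Ω}
    {v v' : Ω → ℝ} {U U' : Set Ω} (h : Characterises K T v U) (h' : Characterises K' T' v' U')
    (hd : Disjoint U U') :
    Characterises (fun Δ => K Δ ∧ K' Δ) (.prob half T T') (half.1 • v + (1 - half.1) • v')
      (U ∪ U') where
  mem_outcomes Δ hΔ := mem_outcomesDist_prob.2
    ⟨v, h.mem_outcomes Δ hΔ.1, v', h'.mem_outcomes Δ hΔ.2, rfl⟩
  of_le Δ o ho hle := by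
    obtain ⟨o₁, ho₁, o₂, ho₂, rfl⟩ := mem_outcomesDist_prob.1 ho
    have c₁ := h.outcomes_subset Δ ho₁
    have c₂ := h'.outcomes_subset Δ ho₂
    refine ⟨h.of_le Δ o₁ ho₁ fun ω => ?_, h'.of_le Δ o₂ ho₂ fun ω => ?_⟩
    · by_cases hω : ω ∈ U
      · have hω' : ω ∉ U' := Set.disjoint_left.1 hd hω
        have := hle ω
        simp only [half, Pi.add_apply, Pi.smul_apply, smul_eq_mul, c₂.2.1 ω hω',
          h'.mem_subUnit.2.1 ω hω'] at this
        linarith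
      · rw [c₁.2.1 ω hω]
        exact h.mem_subUnit.1 ω
    · by_cases hω : ω ∈ U'
      · have hω' : ω ∉ U := Set.disjoint_right.1 hd hω
        have := hle ω
        simp only [half, Pi.add_apply, Pi.smul_apply, smul_eq_mul, c₁.2.1 ω hω',
          h.mem_subUnit.2.1 ω hω'] at this
        linarith
      · rw [c₂.2.1 ω hω]
        exact h'.mem_subUnit.1 ω
  outcomes_subset Δ := by
    intro o ho
    obtain ⟨o₁, ho₁, o₂, ho₂, rfl⟩ := mem_outcomesDist_prob.1 ho
    exact half_add_half_mem_subUnit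
      (subUnit_mono Set.subset_union_left (h.outcomes_subset Δ ho₁))
      (subUnit_mono Set.subset_union_right (h'.outcomes_subset Δ ho₂))
  mem_subUnit := half_add_half_mem_subUnit
    (subUnit_mono Set.subset_union_left h.mem_subUnit)
    (subUnit_mono Set.subset_union_right h'.mem_subUnit)

-- Tests for the diamond modality and for refusals

theorem expect_apply_eq_zero {n : ℕ} {q : FDist (Fin n)} (hq : ∀ i, 0 < q.weights i)
    {o : Fin n → Ω → ℝ} {ω : Ω} (ho : ∀ i, 0 ≤ o i ω) (h : FDist.expect q o ω = 0) (i : Fin n) :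
    o i ω = 0 := by
  rw [FDist.expect_apply, FDist.expect_fintype] at h
  have := (Finset.sum_eq_zero_iff_of_nonneg fun i _ => mul_nonneg (hq i).le (ho i)).1 h i
    (Finset.mem_univ i)
  exact (mul_eq_zero.1 this).resolve_left (hq i).ne'

/-- The test that offers `a`, followed by `T`, and otherwise reports `ω`. -/
def diamTest (ω : Ω) (a : Act) (T : OmegaTest Act Ω) : State Act Ω :=
  .ext (successTest ω) (.pre (Sum.inl a) T)

theorem step_diamTest {ω : Ω} {a : Act} {T : OmegaTest Act Ω} {α : Label Act Ω}
    {Γ : FDist (State Act Ω)} (h : Step (diamTest ω a T) α Γ) :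
    α = succ ω ∧ Γ = StdSimplex.single .nil ∨ α = vis a ∧ Γ = T.den := by
  cases h with
  | ext_l h => cases h with | action => exact Or.inl ⟨rfl, rfl⟩
  | ext_r h => cases h with | action => exact Or.inr ⟨rfl, rfl⟩
  | ext_i_l h => cases h
  | ext_i_r h => cases h

/-- The composite cannot deadlock, since `ω` is always on offer. An outcome that vanishes at `ω`
therefore arises from handshakes on `a` alone, after internal moves of the process. -/
theorem expectSet_outcomesState_diamTest_subset {ω : Ω} {a : Act} {T : OmegaTest Act Ω} {U : Set Ω}
    (hT : ∀ Δ, outcomesDist T Δ ⊆ subUnit U) (Δ : FDist (PureState Act)) :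
    FDist.expectSet Δ (outcomesState (diamTest ω a T)) ⊆
      {o | o ∈ subUnit (insert ω U) ∧
        (o ω = 0 → ∃ Δ', WeakVis a Δ Δ' ∧ o ∈ outcomesDist T Δ')} := by
  refine expectSet_outcomesState_subset (W := fun Δ => {o | o ∈ subUnit (insert ω U) ∧
    (o ω = 0 → ∃ Δ', WeakVis a Δ Δ' ∧ o ∈ outcomesDist T Δ')}) ?_ ?_ ?_ ?_ ?_ Δ
  · intro n q hq Δ o ho
    refine ⟨FDist.expect_mem (convex_subUnit _) fun i _ => (ho i).1, fun h0 => ?_⟩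
    have h0' := expect_apply_eq_zero hq (fun i => (ho i).1.1 ω) h0
    choose Δ' h₁ h₂ using fun i => (ho i).2 (h0' i)
    exact ⟨_, weakVis_mix h₁, (FDist.mem_expectSet_mix fun s => convex_outcomes _ _).2
      ⟨o, h₂, rfl⟩⟩
  · rintro s Δ h o ⟨ho, ho'⟩
    refine ⟨ho, fun h0 => ?_⟩
    obtain ⟨Δ', h₁, h₂⟩ := ho' h0
    exact ⟨Δ', (weakTau_of_step h).trans_weakVis h₁, h₂⟩
  · intro s α Γ o h hα ho
    rcases step_diamTest h with ⟨rfl, rfl⟩ | ⟨rfl, rfl⟩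
    · rw [FDist.expectSet_single fun t => outcomesState_nonempty t s] at ho
      obtain rfl : o = 0 := outcomesState_nil s ho
      rw [bang_succ_zero]
      exact ⟨point_mem_subUnit (Set.mem_insert _ _), fun h0 => by simp at h0⟩
    · exact absurd rfl (hα a)
  · intro s b Γ Δ h hs o ho
    rcases step_diamTest h with ⟨hb, -⟩ | ⟨hb, rfl⟩
    · simp at hb
    · obtain rfl : b = a := by simpa using hb
      rw [← outcomesDist_eq] at ho
      exact ⟨subUnit_mono (Set.subset_insert _ _) (hT Δ ho), fun _ =>
        ⟨Δ, ⟨_, _, .refl _, lift_single hs, .refl _⟩, ho⟩⟩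
  · intro s h _
    obtain ⟨b, hb, -⟩ := h (succ ω) _ (.ext_l (.action _ _))
    simp at hb

theorem Characterises.diam {K : FDist (PureState Act) → Prop} {T : OmegaTest Act Ω} {v : Ω → ℝ}
    {U : Set Ω} (h : Characterises K T v U) {ω : Ω} (hω : ω ∉ U) (a : Act) :
    Characterises (fun Δ => ∃ Δ', WeakVis a Δ Δ' ∧ K Δ') (.state (diamTest ω a T)) v
      (insert ω U) where
  mem_outcomes := by
    rintro Δ ⟨Θ, ⟨Δ₁, Δ₂, h₁, h₂, h₃⟩, hK⟩
    refine outcomesDist_subset_of_weakTau _ h₁ ?_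
    rw [outcomesDist_state]
    refine expectSet_subset_of_lift (convex_outcomesState _) (outcomesState_nonempty _) ?_ h₂
      (outcomesDist_subset_of_weakTau T h₃ (h.mem_outcomes Θ hK))
    exact fun s Φ hs => outcomesDist_subset_outcomesState_of_sync (.ext_r (.action _ _)) hs
  of_le Δ o ho hle := by
    rw [outcomesDist_state] at ho
    obtain ⟨ho, ho'⟩ := expectSet_outcomesState_diamTest_subset h.outcomes_subset Δ ho
    -- Freshness of `ω` gives `v ω = 0`, so an outcome below `v` never took the escape.
    have h0 : o ω = 0 := le_antisymm ((hle ω).trans_eq (h.mem_subUnit.2.1 ω hω)) (ho.1 ω)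
    obtain ⟨Δ', h₁, h₂⟩ := ho' h0
    exact ⟨Δ', h₁, h.of_le Δ' o h₂ hle⟩
  outcomes_subset Δ o ho := by
    rw [outcomesDist_state] at ho
    exact (expectSet_outcomesState_diamTest_subset h.outcomes_subset Δ ho).1
  mem_subUnit := subUnit_mono (Set.subset_insert _ _) h.mem_subUnit

/-- The test that reports `ω` when one of the listed actions is performed. -/
def refTest (ω : Ω) (l : List Act) : State Act Ω :=
  l.foldr (fun a t => .ext (.pre (Sum.inl a) (.state (successTest ω))) t) .nil

theorem step_refTest {ω : Ω} {l : List Act} {α : Label Act Ω} {Γ : FDist (State Act Ω)} :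
    Step (refTest ω l) α Γ ↔
      ∃ a ∈ l, α = vis a ∧ Γ = (Proc.state (successTest ω : State Act Ω)).den := by
  induction l generalizing α Γ with
  | nil =>
    constructor
    · intro h
      cases h
    · rintro ⟨a, ha, -⟩
      cases ha
  | cons a l ih =>
    constructor
    · intro h
      have hind : Step (refTest ω l) α Γ → ∃ b ∈ a :: l, α = vis b ∧
          Γ = (Proc.state (successTest ω : State Act Ω)).den := fun h => by
        obtain ⟨b, hb, h⟩ := ih.1 h
        exact ⟨b, List.mem_cons_of_mem a hb, h⟩
      cases h with
      | ext_l h => cases h with | action => exact ⟨a, List.mem_cons_self, rfl, rfl⟩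
      | ext_r h => exact hind h
      | ext_i_l h => cases h
      | ext_i_r h =>
        obtain ⟨b, -, h, -⟩ := ih.1 h
        simp at h
    · rintro ⟨b, hb, rfl, rfl⟩
      rcases List.mem_cons.1 hb with rfl | hb
      · exact .ext_l (.action _ _)
      · exact .ext_r (ih.2 ⟨b, hb, rfl, rfl⟩)

/-- Every handshake leads to `ω`, so an outcome vanishing there comes only from deadlocks, and a
deadlocked process is stable and refuses all listed actions. -/
theorem expectSet_outcomesState_refTest_subset (ω : Ω) (l : List Act)
    (Δ : FDist (PureState Act)) :
    FDist.expectSet Δ (outcomesState (refTest ω l)) ⊆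
      {o | o ∈ subUnit {ω} ∧
        (o ω = 0 → ∃ Δ', WeakTau Δ Δ' ∧ RefusesDist Δ' {a | a ∈ l})} := by
  refine expectSet_outcomesState_subset (W := fun Δ => {o | o ∈ subUnit {ω} ∧
    (o ω = 0 → ∃ Δ', WeakTau Δ Δ' ∧ RefusesDist Δ' {a | a ∈ l})}) ?_ ?_ ?_ ?_ ?_ Δ
  · intro n q hq Δ o ho
    refine ⟨FDist.expect_mem (convex_subUnit _) fun i _ => (ho i).1, fun h0 => ?_⟩
    have h0' := expect_apply_eq_zero hq (fun i => (ho i).1.1 ω) h0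
    choose Δ' h₁ h₂ using fun i => (ho i).2 (h0' i)
    refine ⟨_, weakTau_mix fun i _ => h₁ i, fun s hs => ?_⟩
    obtain ⟨i, -, hi⟩ := FDist.mem_support_mix hs
    exact h₂ i s hi
  · rintro s Δ h o ⟨ho, ho'⟩
    refine ⟨ho, fun h0 => ?_⟩
    obtain ⟨Δ', h₁, h₂⟩ := ho' h0
    exact ⟨Δ', (weakTau_of_step h).trans h₁, h₂⟩
  · intro s α Γ o h hα ho
    obtain ⟨a, -, rfl, -⟩ := step_refTest.1 h
    exact absurd rfl (hα a)
  · intro s b Γ Δ h hs o ho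
    obtain ⟨a, -, -, rfl⟩ := step_refTest.1 h
    rw [← outcomesDist_eq, outcomesDist_successTest] at ho
    obtain rfl : o = point ω := ho
    exact ⟨point_mem_subUnit rfl, fun h0 => by simp at h0⟩
  · intro s h hs
    refine ⟨zero_mem_subUnit _, fun _ => ⟨_, .refl _, fun t ht => ?_⟩⟩
    obtain rfl : t = s := by
      simpa using Finsupp.support_single_subset ht
    refine ⟨hs, fun a ha Δ hΔ => ?_⟩
    obtain ⟨b, hb, hn⟩ := h _ _ (step_refTest.2 ⟨a, ha, rfl, rfl⟩)
    obtain rfl : a = b := by simpa using hb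
    exact hn Δ hΔ

theorem characterises_ref (ω : Ω) (l : List Act) :
    Characterises (fun Δ => ∃ Δ', WeakTau Δ Δ' ∧ RefusesDist Δ' {a | a ∈ l})
      (.state (refTest ω l) : OmegaTest Act Ω) 0 {ω} where
  mem_outcomes := by
    rintro Δ ⟨Δ', h, href⟩
    refine outcomesDist_subset_of_weakTau _ h ?_
    rw [outcomesDist_state, ← FDist.expect_const Δ' (0 : Ω → ℝ)]
    refine FDist.mem_expectSet (outcomesState_nonempty _) fun s hs =>
      zero_mem_outcomesState (fun α Γ hα => ?_) (href s hs).1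
    obtain ⟨a, ha, rfl, -⟩ := step_refTest.1 hα
    exact ⟨a, rfl, (href s hs).2 a ha⟩
  of_le Δ o ho hle := by
    rw [outcomesDist_state] at ho
    obtain ⟨ho, ho'⟩ := expectSet_outcomesState_refTest_subset ω l Δ ho
    exact ho' (le_antisymm (hle ω) (ho.1 ω))
  outcomes_subset Δ o ho := by
    rw [outcomesDist_state] at ho
    exact (expectSet_outcomesState_refTest_subset ω l Δ ho).1
  mem_subUnit := zero_mem_subUnit _

end

section

variable {Act Ω I : Type*}

/-! ### Internal choice -/

/-- The internal choice between the terms `T i` for `i = i₀` and `i ∈ l`. -/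
def intChoice (T : I → Proc Act Ω) (i₀ : I) (l : List I) : State Act Ω :=
  l.foldr (fun i t => .int (T i) (.state t)) (.int (T i₀) (T i₀))

theorem weakTau_intChoice (T : I → Proc Act Ω) (i₀ : I) {l : List I} {i : I} (hi : i ∈ l) :
    WeakTau (StdSimplex.single (intChoice T i₀ l)) (T i).den := by
  induction l with
  | nil => cases hi
  | cons j l ih =>
    rcases List.mem_cons.1 hi with rfl | hi
    · exact weakTau_of_step (.int_l _ _)
    · exact (weakTau_of_step (.int_r _ _)).trans (ih hi)

theorem weakTau_intChoice_mix (T : I → Proc Act Ω) (i₀ : I) {l : List I} (hl : ∀ i, i ∈ l)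
    (p : FDist I) :
    WeakTau (StdSimplex.single (intChoice T i₀ l)) (FDist.mix p fun i => (T i).den) := by
  have := weakTau_mix (p := p) fun i _ => weakTau_intChoice T i₀ (hl i)
  rwa [FDist.mix_const] at this

theorem outcomes_subset_outcomesState_intChoice (T : I → OmegaTest Act Ω) (i₀ : I) {l : List I}
    {i : I} (hi : i ∈ l) (s : PureState Act) :
    outcomes (T i) (.state s) ⊆ outcomesState (intChoice T i₀ l) s := by
  induction l with
  | nil => cases hi
  | cons j l ih =>
    intro o ho
    rcases List.mem_cons.1 hi with rfl | hi
    · rw [outcomes_state] at ho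
      rw [← bang_tau (Act := Act) o]
      exact bang_mem_outcomesState (.int_l _ _) (fun a h => by simp at h) ho
    · rw [← bang_tau (Act := Act) o]
      refine bang_mem_outcomesState (.int_r _ _) (fun a h => by simp at h) ?_
      rw [Proc.den, FDist.expectSet_single fun t => outcomesState_nonempty t s]
      exact ih hi ho

theorem expectSet_outcomesState_int_subset {T T' : OmegaTest Act Ω}
    {W : FDist (PureState Act) → Set (Ω → ℝ)} (hW : ConvexFamily W)
    (htau : ∀ s Δ, Step s tau Δ → W Δ ⊆ W (StdSimplex.single s))
    (hT : ∀ s, outcomes T (.state s) ⊆ W (StdSimplex.single s))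
    (hT' : ∀ s, outcomes T' (.state s) ⊆ W (StdSimplex.single s)) (Δ : FDist (PureState Act)) :
    FDist.expectSet Δ (outcomesState (.int T T')) ⊆ W Δ := by
  refine expectSet_outcomesState_subset hW htau ?_ (fun _ _ _ _ h => by cases h) ?_ Δ
  · intro s α Γ o h _ ho
    cases h with
    | int_l => rw [bang_tau]; rw [← outcomes_state] at ho; exact hT s ho
    | int_r => rw [bang_tau]; rw [← outcomes_state] at ho; exact hT' s ho
  · intro s h _
    obtain ⟨a, ha, -⟩ := h _ _ (.int_l _ _)
    simp at ha

/-- The distribution `μ` records jointly which alternative the test selects and the state of the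
process at that moment. -/
theorem expectSet_outcomesState_intChoice_subset (T : I → OmegaTest Act Ω) (i₀ : I) (l : List I)
    (Δ : FDist (PureState Act)) :
    FDist.expectSet Δ (outcomesState (intChoice T i₀ l)) ⊆
      {o | ∃ μ : FDist (I × PureState Act), WeakTau Δ (μ.map Prod.snd) ∧
        o ∈ FDist.expectSet μ fun x => outcomes (T x.1) (.state x.2)} := by
  let W : FDist (PureState Act) → Set (Ω → ℝ) := fun Δ =>
    {o | ∃ μ : FDist (I × PureState Act), WeakTau Δ (μ.map Prod.snd) ∧
      o ∈ FDist.expectSet μ fun x => outcomes (T x.1) (.state x.2)}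
  have hW : ConvexFamily W := by
    intro n q _ Δ o ho
    choose μ h₁ h₂ using ho
    refine ⟨FDist.mix q μ, ?_, (FDist.mem_expectSet_mix fun _ => convex_outcomes _ _).2
      ⟨o, h₂, rfl⟩⟩
    rw [FDist.map_mix]
    exact weakTau_mix fun i _ => h₁ i
  have htau : ∀ s Δ, Step s tau Δ → W Δ ⊆ W (StdSimplex.single s) := by
    rintro s Δ h o ⟨μ, h₁, h₂⟩
    exact ⟨μ, (weakTau_of_step h).trans h₁, h₂⟩
  have hT : ∀ i s, outcomes (T i) (.state s) ⊆ W (StdSimplex.single s) := by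
    intro i s o ho
    refine ⟨StdSimplex.single (i, s), by simpa using WeakTau.refl _, ?_⟩
    rwa [FDist.expectSet_single fun x => outcomes_nonempty _ _]
  have key : ∀ Δ, FDist.expectSet Δ (outcomesState (intChoice T i₀ l)) ⊆ W Δ := by
    induction l with
    | nil => exact expectSet_outcomesState_int_subset hW htau (hT i₀) (hT i₀)
    | cons i l ih =>
      refine expectSet_outcomesState_int_subset hW htau (hT i) fun s => ?_
      have := ih (StdSimplex.single s)
      rwa [← outcomesDist_state, outcomesDist_single] at this
  exact key Δ

/-! ### Satisfiability of formulae -/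

theorem sat_of_weakTau {Δ Δ' : FDist (PureState Act)} (h : WeakTau Δ Δ') (φ : Formula Act)
    (hφ : Sat Δ' φ) : Sat Δ φ := by
  induction φ with
  | ref X =>
    obtain ⟨Θ, h₁, h₂⟩ := hφ
    exact ⟨Θ, h.trans h₁, h₂⟩
  | diam a φ _ =>
    obtain ⟨Θ, h₁, h₂⟩ := hφ
    exact ⟨Θ, h.trans_weakVis h₁, h₂⟩
  | conj n φ ih => exact fun i => ih i (hφ i)
  | psum n p φ _ =>
    obtain ⟨Θ, h₁, h₂⟩ := hφ
    exact ⟨Θ, h₁, h.trans h₂⟩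

/-- Needed for alternatives of probability 0 in a probabilistic choice: satisfaction demands a
witness for them, but no outcome can provide one. -/
theorem exists_sat (φ : Formula Act) : ∃ s : PureState Act, Sat (StdSimplex.single s) φ := by
  induction φ with
  | ref X =>
    refine ⟨.nil, StdSimplex.single .nil, .refl _, fun s hs => ?_⟩
    obtain rfl : s = .nil := by simpa using Finsupp.support_single_subset hs
    exact ⟨fun _ h => (by cases h), fun _ _ _ h => (by cases h)⟩
  | diam a φ ih =>
    obtain ⟨s, hs⟩ := ih
    exact ⟨.pre (Sum.inl a) (.state s), _,
      ⟨_, _, .refl _, lift_single (.action _ _), .refl _⟩, hs⟩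
  | conj n φ ih =>
    choose s hs using ih
    rcases n with _ | n
    · exact ⟨.nil, fun i => i.elim0⟩
    · exact ⟨intChoice (fun i => .state (s i)) 0 (List.finRange _), fun i =>
        sat_of_weakTau (weakTau_intChoice _ 0 (List.mem_finRange i)) _ (hs i)⟩
  | psum n p φ ih =>
    choose s hs using ih
    obtain ⟨i₀, -⟩ := p.exists_mem_support
    exact ⟨intChoice (fun i => .state (s i)) i₀ (List.finRange _),
      fun i => StdSimplex.single (s i), hs,
      weakTau_intChoice_mix (fun i => .state (s i)) i₀ List.mem_finRange p⟩

/-! ### Characteristic tests for probabilistic choice -/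

/-- The tuple that is averaged by the test for a probabilistic choice. -/
def markedTuple {n : ℕ} (ω : Fin n → Ω) (a : Fin n → Ω → ℝ) (i : Fin n) : Ω → ℝ :=
  half.1 • a i + (1 - half.1) • point (ω i)

section Marked

variable {n : ℕ} {ω : Fin n → Ω} {U : Fin n → Set Ω} {a : Fin n → Ω → ℝ}

/-- Only alternative `j` contributes at its mark, so this coordinate reveals its weight. -/
theorem expect_markedTuple_mark (hω : Function.Injective ω) (hωU : ∀ i j, ω i ∉ U j)
    (ha : ∀ i, a i ∈ subUnit (U i)) (q : FDist (Fin n)) (j : Fin n) :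
    FDist.expect q (markedTuple ω a) (ω j) = q.weights j / 2 := by
  rw [FDist.expect_apply, FDist.expect_fintype, Finset.sum_eq_single j]
  · simp [markedTuple, half, (ha j).2.1 _ (hωU j j)]
    ring
  · intro i _ hij
    simp [markedTuple, (ha i).2.1 _ (hωU j i), point_of_ne fun h => hij (hω h).symm]
  · simp

theorem expect_markedTuple_of_mem (hU : Pairwise fun i j => Disjoint (U i) (U j))
    (hωU : ∀ i j, ω i ∉ U j) (ha : ∀ i, a i ∈ subUnit (U i)) (q : FDist (Fin n)) {j : Fin n}
    {w : Ω} (hw : w ∈ U j) :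
    FDist.expect q (markedTuple ω a) w = q.weights j * a j w / 2 := by
  have hne : ∀ i, w ≠ ω i := fun i h => hωU i j (h ▸ hw)
  rw [FDist.expect_apply, FDist.expect_fintype, Finset.sum_eq_single j]
  · simp [markedTuple, half, point_of_ne (hne j)]
    ring
  · intro i _ hij
    simp [markedTuple, (ha i).2.1 w (Set.disjoint_right.1 (hU hij) hw), point_of_ne (hne i)]
  · simp

theorem expect_markedTuple_mem_subUnit (ha : ∀ i, a i ∈ subUnit (U i)) {V : Set Ω}
    (hUV : ∀ i, U i ⊆ V) (hωV : ∀ i, ω i ∈ V) (q : FDist (Fin n)) :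
    FDist.expect q (markedTuple ω a) ∈ subUnit V :=
  FDist.expect_mem (convex_subUnit V) fun i _ =>
    half_add_half_mem_subUnit (subUnit_mono (hUV i) (ha i)) (point_mem_subUnit (hωV i))

theorem hasSum_expect_markedTuple (ha : ∀ i, HasSum (a i) 1) (q : FDist (Fin n)) :
    HasSum (FDist.expect q (markedTuple ω a)) 1 := by
  rw [FDist.expect_fintype, ← q.sum_weights]
  have : ∀ i ∈ Finset.univ, HasSum (q.weights i • markedTuple ω a i) (q.weights i) := by
    intro i _
    have := (hasSum_half_add_half (ha i) (hasSum_point (ω i))).mul_left (q.weights i)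
    rwa [mul_one] at this
  convert hasSum_sum this using 1
  funext w
  simp

/-- Conditioning `μ` on the selected alternative groups the outcomes by test; within a group the
mark is constant. -/
theorem exists_eq_expect_markedTuple {T : Fin n → OmegaTest Act Ω}
    {μ : FDist (Fin n × PureState Act)} {o : Ω → ℝ}
    (ho : o ∈ FDist.expectSet μ fun x =>
      outcomes (.prob half (T x.1) (.state (successTest (ω x.1)))) (.state x.2)) :
    ∃ (q : FDist (Fin n)) (κ : Fin n → FDist (PureState Act)) (a : Fin n → Ω → ℝ),
      μ.map Prod.snd = FDist.mix q κ ∧ (∀ i, a i ∈ outcomesDist (T i) (κ i)) ∧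
      o = FDist.expect q (markedTuple ω a) := by
  obtain ⟨f, hf, rfl⟩ := ho
  have key : ∀ x : Fin n × PureState Act, ∃ g ∈ outcomes (T x.1) (.state x.2),
      f x = half.1 • g + (1 - half.1) • point (ω x.1) := by
    intro x
    have := hf x
    dsimp only at this
    rw [← outcomesDist_single, mem_outcomesDist_prob] at this
    obtain ⟨g, hg, g', hg', h⟩ := this
    rw [outcomesDist_single] at hg
    rw [outcomesDist_successTest] at hg'
    obtain rfl : g' = _ := hg'
    exact ⟨g, hg, h⟩
  choose g hg hfg using key
  obtain ⟨κ, hκ⟩ := μ.exists_disintegration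
  refine ⟨μ.map Prod.fst, κ, fun i => FDist.expect (κ i) fun s => g (i, s), ?_,
    fun i => ⟨fun s => g (i, s), fun s => hg (i, s), rfl⟩, ?_⟩
  · conv_lhs => rw [hκ]
    simp only [FDist.map_mix, StdSimplex.map_map]
    congr
    funext i
    exact StdSimplex.map_id _
  · have := congrArg (fun ν => FDist.expect ν f) hκ
    simp only [FDist.expect_mix] at this
    rw [this]
    congr 1
    funext i
    rw [FDist.expect_map, funext fun s => hfg (i, s), FDist.expect_add, FDist.expect_smul]
    exact congrArg _ (FDist.expect_const (κ i) ((1 - half.1) • point (ω i)))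

/-- The test for a probabilistic choice with the component tests `T i` and the marks `ω i`. -/
def psumTest (T : Fin n → OmegaTest Act Ω) (ω : Fin n → Ω) (i₀ : Fin n) : OmegaTest Act Ω :=
  .state (intChoice (fun i => .prob half (T i) (.state (successTest (ω i)))) i₀
    (List.finRange n))

theorem exists_of_mem_outcomesDist_psumTest {T : Fin n → OmegaTest Act Ω} {i₀ : Fin n}
    {Δ : FDist (PureState Act)} {o : Ω → ℝ} (ho : o ∈ outcomesDist (psumTest T ω i₀) Δ) :
    ∃ (q : FDist (Fin n)) (κ : Fin n → FDist (PureState Act)) (a : Fin n → Ω → ℝ),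
      WeakTau Δ (FDist.mix q κ) ∧ (∀ i, a i ∈ outcomesDist (T i) (κ i)) ∧
      o = FDist.expect q (markedTuple ω a) := by
  rw [psumTest, outcomesDist_state] at ho
  obtain ⟨μ, h, hμ⟩ := expectSet_outcomesState_intChoice_subset _ _ _ Δ ho
  obtain ⟨q, κ, a, hκ, h'⟩ := exists_eq_expect_markedTuple hμ
  exact ⟨q, κ, a, hκ ▸ h, h'⟩

theorem characterises_psum {K : Fin n → FDist (PureState Act) → Prop}
    {T : Fin n → OmegaTest Act Ω} {v : Fin n → Ω → ℝ}
    (h : ∀ i, Characterises (K i) (T i) (v i) (U i)) (hK : ∀ i, ∃ Δ, K i Δ)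
    (hU : Pairwise fun i j => Disjoint (U i) (U j)) (hω : Function.Injective ω)
    (hωU : ∀ i j, ω i ∉ U j) {V : Set Ω} (hUV : ∀ i, U i ⊆ V) (hωV : ∀ i, ω i ∈ V)
    (p : FDist (Fin n)) (i₀ : Fin n) :
    Characterises (fun Δ => ∃ Θ : Fin n → FDist (PureState Act), (∀ i, K i (Θ i)) ∧
      WeakTau Δ (FDist.mix p Θ)) (psumTest T ω i₀) (FDist.expect p (markedTuple ω v)) V where
  mem_outcomes := by
    rintro Δ ⟨Θ, hΘ, hΔ⟩
    refine outcomesDist_subset_of_weakTau _ hΔ ?_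
    rw [psumTest, outcomesDist_state, FDist.mem_expectSet_mix (convex_outcomesState _)]
    refine ⟨_, fun i => FDist.expectSet_mono (fun s => outcomes_subset_outcomesState_intChoice
      _ i₀ (List.mem_finRange i) s) ?_, rfl⟩
    refine mem_outcomesDist_prob.2 ⟨v i, (h i).mem_outcomes _ (hΘ i), _, ?_, rfl⟩
    rw [outcomesDist_successTest]
    rfl
  of_le Δ o ho hle := by
    classical
    obtain ⟨q, κ, a, hκ, ha, rfl⟩ := exists_of_mem_outcomesDist_psumTest ho
    have ha' : ∀ i, a i ∈ subUnit (U i) := fun i => (h i).outcomes_subset _ (ha i)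
    have hqp : ∀ j ∈ Finset.univ, q.weights j ≤ p.weights j := by
      intro j _
      have := hle (ω j)
      rw [expect_markedTuple_mark hω hωU ha',
        expect_markedTuple_mark hω hωU fun i => (h i).mem_subUnit] at this
      linarith
    -- Comparison at the marks gives `q ≤ p`; equal totals turn it into equality.
    have hqp' := (Finset.sum_eq_sum_iff_of_le hqp).1 (q.sum_weights.trans p.sum_weights.symm)
    obtain rfl : q = p := StdSimplex.ext (Finsupp.ext fun j => hqp' j (Finset.mem_univ j))
    choose Ψ hΨ using hK
    -- At weight 0 the conditional `κ i` carries no information, so an arbitrary witness `Ψ i`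
    -- replaces it without changing the mixture.
    refine ⟨fun i => if i ∈ q.weights.support then κ i else Ψ i, fun i => ?_, ?_⟩
    · dsimp only
      split_ifs with hi
      · refine (h i).of_le _ _ (ha i) fun w => ?_
        by_cases hw : w ∈ U i
        · have := hle w
          rw [expect_markedTuple_of_mem hU hωU ha' q hw,
            expect_markedTuple_of_mem hU hωU (fun i => (h i).mem_subUnit) q hw] at this
          have hpos : 0 < q.weights i :=
            lt_of_le_of_ne (q.weights_nonneg i) (Ne.symm (Finsupp.mem_support_iff.1 hi))
          exact le_of_mul_le_mul_left (by linarith) hpos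
        · rw [(ha' i).2.1 w hw]
          exact (h i).mem_subUnit.1 w
      · exact hΨ i
    · rwa [FDist.mix_congr (Θ := κ) fun i hi => if_pos hi]
  outcomes_subset Δ o ho := by
    obtain ⟨q, κ, a, -, ha, rfl⟩ := exists_of_mem_outcomesDist_psumTest ho
    exact expect_markedTuple_mem_subUnit (fun i => (h i).outcomes_subset _ (ha i)) hUV hωV q
  mem_subUnit := expect_markedTuple_mem_subUnit (fun i => (h i).mem_subUnit) hUV hωV p

end Marked

/-! ### Characteristic tests for all formulae -/

/-- The even and odd terms of `e` supply disjoint sets of success actions for the first conjunct and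
for the others. The predicate `L` stands for membership in `𝓛`. -/
theorem exists_characterises_conj {n : ℕ} (K : Fin n → FDist (PureState Act) → Prop)
    (L : Fin n → Prop)
    (h : ∀ i, ∀ e : ℕ → Ω, Function.Injective e → ∃ (T : OmegaTest Act Ω) (v : Ω → ℝ),
      Characterises (K i) T v (Set.range e) ∧ (L i → HasSum v 1))
    (e : ℕ → Ω) (he : Function.Injective e) : ∃ (T : OmegaTest Act Ω) (v : Ω → ℝ),
      Characterises (fun Δ => ∀ i, K i Δ) T v (Set.range e) ∧ ((∀ i, L i) → HasSum v 1) := by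
  induction n generalizing e with
  | zero =>
    exact ⟨_, _, ((characterises_true (e 0)).congr fun Δ => iff_of_true trivial
      fun i => i.elim0).mono (Set.singleton_subset_iff.2 (Set.mem_range_self 0)),
      fun _ => hasSum_point (e 0)⟩
  | succ n ih =>
    have h₀ : Function.Injective fun k => e (2 * k) := fun a b hab => by
      have := he hab
      omega
    have h₁ : Function.Injective fun k => e (2 * k + 1) := fun a b hab => by
      have := he hab
      omega
    obtain ⟨T, v, hT, hv⟩ := h 0 _ h₀
    obtain ⟨T', v', hT', hv'⟩ := ih (fun i => K i.succ) (fun i => L i.succ) (fun i => h i.succ) _ h₁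
    refine ⟨_, _, ((hT.and hT' ?_).congr fun Δ =>
      (Fin.forall_fin_succ (P := fun i => K i Δ)).symm).mono ?_, fun hL =>
      hasSum_half_add_half (hv (hL 0)) (hv' fun i => hL i.succ)⟩
    · rw [Set.disjoint_left]
      rintro _ ⟨a, rfl⟩ ⟨b, hb⟩
      have := he hb
      omega
    · exact Set.union_subset (Set.range_comp_subset_range _ e) (Set.range_comp_subset_range _ e)

/-- Quantifying over the sequence `e` lets the induction hypothesis be applied along subsequences
with disjoint ranges, which provides freshness. -/
theorem exists_characterises [Finite Act] (φ : Formula Act) :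
    ∀ e : ℕ → Ω, Function.Injective e → ∃ (T : OmegaTest Act Ω) (v : Ω → ℝ),
      Characterises (fun Δ => Sat Δ φ) T v (Set.range e) ∧ (φ.InL → HasSum v 1) := by
  induction φ with
  | ref X =>
    intro e _
    exact ⟨_, _, ((characterises_ref (e 0) X.toFinite.toFinset.toList).congr fun Δ => by
      simp [Sat]).mono (Set.singleton_subset_iff.2 (Set.mem_range_self 0)), fun h => h.elim⟩
  | diam a φ ih =>
    intro e he
    obtain ⟨T, v, hT, hv⟩ := ih (fun k => e (k + 1)) fun a b hab => Nat.succ_injective (he hab)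
    refine ⟨_, v, (hT.diam (ω := e 0) ?_ a).mono ?_, hv⟩
    · rintro ⟨k, hk⟩
      exact Nat.succ_ne_zero k (he hk)
    · exact Set.insert_subset (Set.mem_range_self 0) (Set.range_comp_subset_range _ e)
  | conj n φ ih => exact exists_characterises_conj _ _ ih
  | psum n p φ ih =>
    intro e he
    -- Pairing splits `e` into disjoint sequences: position `(i, 0)` is the mark of alternative `i`,
    -- and the positions `(i, k + 1)` serve its test.
    have he' : ∀ i k j l, e (Nat.pair i k) = e (Nat.pair j l) → i = j ∧ k = l :=
      fun i k j l h => Nat.pair_eq_pair.1 (he h)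
    have hinj : ∀ i : Fin n, Function.Injective fun k => e (Nat.pair i (k + 1)) :=
      fun i k l h => Nat.succ_injective (he' _ _ _ _ h).2
    choose T v hT hv using fun i => ih i _ (hinj i)
    obtain ⟨i₀, -⟩ := p.exists_mem_support
    refine ⟨_, _, characterises_psum (ω := fun i : Fin n => e (Nat.pair i 0)) hT
      (fun i => (exists_sat (φ i)).imp' _ fun _ hs => hs) ?_ ?_ ?_
      (fun i => Set.range_subset_iff.2 fun k => Set.mem_range_self _)
      (fun i => Set.mem_range_self _) p i₀,
      fun hL => hasSum_expect_markedTuple (fun i => hv i (hL i)) p⟩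
    · intro i j hij
      rw [Set.disjoint_left]
      rintro _ ⟨k, rfl⟩ ⟨l, hl⟩
      exact hij (Fin.ext (he' _ _ _ _ hl).1.symm)
    · exact fun i j hij => Fin.ext (he' _ _ _ _ hij).1
    · rintro i j ⟨k, hk⟩
      exact Nat.succ_ne_zero k (he' _ _ _ _ hk).2

theorem exists_characteristic_test [Finite Act] [Infinite Ω] (φ : Formula Act) :
    ∃ (T : OmegaTest Act Ω) (v : Ω → ℝ), (∀ ω, v ω ∈ Set.Icc (0 : ℝ) 1) ∧
      (∀ Δ, Sat Δ φ ↔ ∃ o ∈ outcomesDist T Δ, o ≤ v) ∧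
      (φ.InL → ∀ Δ, Sat Δ φ ↔ ∃ o ∈ outcomesDist T Δ, v ≤ o) := by
  obtain ⟨T, v, h, hv⟩ :=
    exists_characterises φ (Infinite.natEmbedding Ω) (Infinite.natEmbedding Ω).injective
  refine ⟨T, v, fun ω => ⟨h.mem_subUnit.1 ω, le_one_of_mem_subUnit h.mem_subUnit ω⟩,
    fun Δ => ⟨fun hΔ => ⟨v, h.mem_outcomes Δ hΔ, le_rfl⟩, fun ⟨o, ho, hle⟩ => h.of_le Δ o ho hle⟩,
    fun hL Δ => ⟨fun hΔ => ⟨v, h.mem_outcomes Δ hΔ, le_rfl⟩, fun ⟨o, ho, hle⟩ => ?_⟩⟩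
  exact h.of_le Δ o ho (eq_of_le_of_mem_subUnit (h.outcomes_subset Δ ho) (hv hL) hle).le

-- From characteristic tests to the logical preorders

theorem VecMay.logicL [Finite Act] [Infinite Ω] {P Q : PureProc Act} (h : VecMay Ω P Q) :
    LogicL P Q := by
  intro φ hφ hP
  obtain ⟨T, v, -, -, hT⟩ := exists_characteristic_test (Ω := Ω) φ
  obtain ⟨o, ho, hv⟩ := (hT hφ _).1 hP
  rw [outcomesDist_den] at ho
  obtain ⟨o', ho', hle⟩ := h T o ho
  rw [hT hφ, outcomesDist_den]
  exact ⟨o', ho', hv.trans hle⟩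

theorem VecMust.logicF [Finite Act] [Infinite Ω] {P Q : PureProc Act} (h : VecMust Ω P Q) :
    LogicF P Q := by
  intro φ hQ
  obtain ⟨T, v, -, hT, -⟩ := exists_characteristic_test (Ω := Ω) φ
  obtain ⟨o, ho, hv⟩ := (hT _).1 hQ
  rw [outcomesDist_den] at ho
  obtain ⟨o', ho', hle⟩ := h T o ho
  rw [hT, outcomesDist_den]
  exact ⟨o', ho', hle.trans hv⟩

end

end PCSP

end

theorem mainTheorem4 {Act : Type*} [Finite Act] {Ω : Type*} [Infinite Ω] :
    (∀ P Q : PCSP.PureProc Act, PCSP.VecMay Ω P Q → PCSP.LogicL P Q) ∧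
    (∀ P Q : PCSP.PureProc Act, PCSP.VecMust Ω P Q → PCSP.LogicF P Q) ∧
    (∀ φ : PCSP.Formula Act, ∃ (T : PCSP.OmegaTest Act Ω) (v : Ω → ℝ),
      (∀ ω, v ω ∈ Set.Icc (0 : ℝ) 1) ∧
      (∀ Δ : PCSP.FDist (PCSP.PureState Act),
        PCSP.Sat Δ φ ↔ ∃ o ∈ PCSP.outcomesDist T Δ, o ≤ v) ∧
      (φ.InL → ∀ Δ : PCSP.FDist (PCSP.PureState Act),
        PCSP.Sat Δ φ ↔ ∃ o ∈ PCSP.outcomesDist T Δ, v ≤ o)) :=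
  ⟨fun _ _ h => h.logicL, fun _ _ h => h.logicF, PCSP.exists_characteristic_test⟩
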